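/- Let $n \ge 1$, and let $X_1, \ldots, X_n$ be independent random vectors in $\mathbb{R}^d$, each with mean zero, with common covariance matrix $\Sigma$ (possibly singular), and with Euclidean norm $\|X_i\| \le \beta$ almost surely for each $i$. Let $S_n = \frac{1}{\sqrt{n}} \sum_{i=1}^n X_i$, and let $Z$ be a Gaussian random vector in $\mathbb{R}^d$ with mean zero and covariance $\Sigma$. Then \[ \mathcal{W}_2(S_n, Z) \le \frac{5 \sqrt{d}\, \beta\, (1 + \log n)}{\sqrt{n}}, \] where $\mathcal{W}_2(X, Y) = \left( \inf_{\gamma} \int \|x - y\|^2 \, d\gamma(x, y) \right)^{1/2}$, the infimum being over all probability measures $\gamma$ on $\mathbb{R}^d \times \mathbb{R}^d$ whose first marginal is the law of $X$ and whose second marginal is the law of $Y$. -/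

import Mathlib

open MeasureTheory ProbabilityTheory
open scoped ENNReal

/-- The set `Γ(μ, ν)` of couplings of `μ` and `ν`: all probability measures on `E × E`
with first marginal `μ` and second marginal `ν`. -/
def couplings {E : Type*} [MeasurableSpace E] (μ ν : Measure E) : Set (Measure (E × E)) :=
  {γ | IsProbabilityMeasure γ ∧ γ.map Prod.fst = μ ∧ γ.map Prod.snd = ν}

/-- The `L^p` transportation distance
`W_p(μ, ν) = (inf_{γ ∈ Γ(μ, ν)} ∫ ‖x - y‖^p dγ(x, y))^(1/p)`, with values in `[0, ∞]`. -/
noncomputable def transportDist {E : Type*} [NormedAddCommGroup E] [MeasurableSpace E]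
    (p : ℝ) (μ ν : Measure E) : ℝ≥0∞ :=
  (⨅ γ ∈ couplings μ ν, ∫⁻ z, ‖z.1 - z.2‖ₑ ^ p ∂γ) ^ (1 / p)

/-- The random vector `X` has covariance matrix `S`: the covariance of the coordinates `j` and `k`
of `X` is the entry `S j k`. -/
def HasCovMatrix {Ω : Type*} [MeasurableSpace Ω] {d : ℕ} (X : Ω → EuclideanSpace ℝ (Fin d))
    (S : Matrix (Fin d) (Fin d) ℝ) (P : Measure Ω) : Prop :=
  ∀ j k, cov[fun ω ↦ X ω j, fun ω ↦ X ω k; P] = S j k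

/-! The summands are exchanged for Gaussians one at a time. If an independent Gaussian with
covariance B is already present, exchanging a vector bounded by β with covariance Σ for a Gaussian
of the same covariance costs O(q β √d) in the transportation distance, where q measures Σ relative
to B. Once k summands have been exchanged, B is kΣ plus a fixed multiple of β², so q = 1/(k + 2)
works; the harmonic sum produces the logarithm (`nearTransport_diagGaussian_conv_convFin`). The
fixed multiple of β² is an auxiliary Gaussian, inserted and removed at a cost of order β √d.

For a single exchange, join the two laws by Y_t = A_t G + (1 - t) X with A_t² = B + (1 - (1 - t)²)
Σ, which keeps the covariance constant. The law of Y_t flows along the conditional mean of the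
velocity A_t' G - X given Y_t, and the time integral of its L² norm bounds the distance. After
rescaling, this conditional mean is a quotient of averages of Gaussian tilts. Equality of
covariances cancels the terms of low order in the numerator, whose second moment is computed through
two independent copies of X; Jensen's inequality bounds the denominator below. This is
`exists_velocity`.

The flow is never constructed. Time is cut into N steps, and an extra Gaussian of scale ρ makes
replacing the true displacement by its conditional mean a second-order error in total variation
(`partialTransport_of_condMean`). N errors of size O(1/N²) vanish in the limit. Total variation does
not control quadratic cost, which is why plans may lose a small mass: these plans compose, and
finite second moments recover full couplings at the end (`NearTransport.transportDist_le`).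

The covariance is diagonalised beforehand by an orthogonal change of coordinates, so all operators
involved are diagonal and Σ may be singular. -/

/-! ### Partial transport plans and their composition -/

/-- A partial transport plan of `μ` to `ν`: a measure with marginals dominated by `μ` and `ν`,
missing at most mass `η`, with quadratic cost at most `a ^ 2`. -/
def PartialTransport {E : Type*} [NormedAddCommGroup E] [MeasurableSpace E]
    (μ ν : Measure E) (a η : ℝ≥0∞) : Prop :=
  ∃ γ : Measure (E × E), γ.map Prod.fst ≤ μ ∧ γ.map Prod.snd ≤ ν ∧ 1 ≤ γ Set.univ + η ∧
    eLpNorm (fun z : E × E ↦ z.1 - z.2) 2 γ ≤ a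

/-- For all `ε > 0`, all but mass `ε` of `μ` can be transported into `ν` at quadratic cost
`(a + ε) ^ 2`. -/
def NearTransport {E : Type*} [NormedAddCommGroup E] [MeasurableSpace E]
    (μ ν : Measure E) (a : ℝ≥0∞) : Prop :=
  ∀ ε : ℝ≥0∞, 0 < ε → PartialTransport μ ν (a + ε) ε

/-- The minimum of the two measures, cut along a Hahn decomposition: `ν` is the smaller one on `s`
and `μ` on its complement. -/
lemma exists_common_le_measure {α : Type*} [MeasurableSpace α] (μ ν : Measure α)
    [IsFiniteMeasure μ] [IsFiniteMeasure ν] :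
    ∃ (m : Measure α) (s : Set α), MeasurableSet s ∧ m ≤ μ ∧ m ≤ ν ∧
      m Set.univ = ν s + μ sᶜ := by
  obtain ⟨s, hs, h1, h2⟩ := hahn_decomposition μ ν
  refine ⟨ν.restrict s + μ.restrict sᶜ, s, hs, ?_, ?_, by simp⟩
  · refine Measure.le_iff.2 fun t ht ↦ ?_
    rw [Measure.add_apply, Measure.restrict_apply ht, Measure.restrict_apply ht,
      ← measure_inter_add_sdiff t hs, Set.sdiff_eq]
    refine add_le_add ?_ le_rfl
    exact h1 _ (ht.inter hs) Set.inter_subset_right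
  · refine Measure.le_iff.2 fun t ht ↦ ?_
    rw [Measure.add_apply, Measure.restrict_apply ht, Measure.restrict_apply ht,
      ← measure_inter_add_sdiff t hs, Set.sdiff_eq]
    refine add_le_add le_rfl ?_
    exact h2 _ (ht.inter hs.compl) Set.inter_subset_right

lemma compProd_mono_left {α β : Type*} [MeasurableSpace α] [MeasurableSpace β]
    {μ ν : Measure α} [SFinite μ] [SFinite ν] (h : μ ≤ ν) (κ : Kernel α β) [IsSFiniteKernel κ] :
    μ ⊗ₘ κ ≤ ν ⊗ₘ κ := by
  refine Measure.le_iff.2 fun t ht ↦ ?_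
  rw [Measure.compProd_apply ht, Measure.compProd_apply ht]
  exact lintegral_mono' h le_rfl

lemma isFiniteMeasure_of_map_le {α β : Type*} [MeasurableSpace α] [MeasurableSpace β]
    {γ : Measure α} {μ : Measure β} [IsFiniteMeasure μ] {f : α → β} (hf : Measurable f)
    (h : γ.map f ≤ μ) : IsFiniteMeasure γ := by
  refine ⟨lt_of_le_of_lt ?_ (measure_lt_top μ Set.univ)⟩
  have := h Set.univ
  rwa [Measure.map_apply hf MeasurableSet.univ, Set.preimage_univ] at this

lemma measure_le_add_of_le {α : Type*} [MeasurableSpace α] {μ ν : Measure α}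
    [IsProbabilityMeasure ν] (h : μ ≤ ν) {η : ℝ≥0∞} (hη : 1 ≤ μ Set.univ + η) {s : Set α}
    (hs : MeasurableSet s) : ν s ≤ μ s + η := by
  have h1 : ν s + ν sᶜ = 1 := by rw [measure_add_measure_compl hs, measure_univ]
  have h2 : μ s + μ sᶜ = μ Set.univ := measure_add_measure_compl hs
  have h3 := h sᶜ
  refine (ENNReal.add_le_add_iff_right (measure_ne_top ν sᶜ)).1 ?_
  calc ν s + ν sᶜ = 1 := h1
    _ ≤ μ s + μ sᶜ + η := by rwa [h2]
    _ ≤ μ s + ν sᶜ + η := by gcongr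
    _ = _ := by ring

section Generic

variable {E : Type*} [NormedAddCommGroup E] [MeasurableSpace E]

lemma PartialTransport.mono {μ ν : Measure E} {a b η θ : ℝ≥0∞} (h : PartialTransport μ ν a η)
    (hab : a ≤ b) (hηθ : η ≤ θ) : PartialTransport μ ν b θ := by
  obtain ⟨γ, h1, h2, h3, h4⟩ := h
  exact ⟨γ, h1, h2, h3.trans (by gcongr), h4.trans hab⟩

lemma NearTransport.mono {μ ν : Measure E} {a b : ℝ≥0∞} (h : NearTransport μ ν a)
    (hab : a ≤ b) : NearTransport μ ν b :=
  fun ε hε ↦ (h ε hε).mono (by gcongr) le_rfl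

lemma NearTransport.map {F : Type*} [NormedAddCommGroup F] [MeasurableSpace F] [BorelSpace F]
    [SecondCountableTopology F] {μ ν : Measure E} {a : ℝ≥0∞}
    (h : NearTransport μ ν a) {f : E → F} (hf : Measurable f) {c : ℝ} (hc : 0 < c)
    (hfc : ∀ x y, ‖f x - f y‖ ≤ c * ‖x - y‖) :
    NearTransport (μ.map f) (ν.map f) (ENNReal.ofReal c * a) := by
  intro ε hε
  have hc' : ENNReal.ofReal c ≠ 0 := by simpa using hc
  -- The cost is multiplied by `c` while the missing mass is unchanged, so both tolerances are
  -- imposed.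
  set δ := min ε (ε / ENNReal.ofReal c) with hδ
  have hδ0 : 0 < δ := lt_min hε (ENNReal.div_pos hε.ne' ENNReal.ofReal_ne_top)
  obtain ⟨γ, h1, h2, h3, h4⟩ := h δ hδ0
  refine ⟨γ.map (Prod.map f f), ?_, ?_, ?_, ?_⟩
  · rw [Measure.map_map measurable_fst (by fun_prop)]
    refine le_trans (le_of_eq ?_) (Measure.map_mono h1 hf)
    rw [Measure.map_map hf measurable_fst]; rfl
  · rw [Measure.map_map measurable_snd (by fun_prop)]
    refine le_trans (le_of_eq ?_) (Measure.map_mono h2 hf)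
    rw [Measure.map_map hf measurable_snd]; rfl
  · rw [Measure.map_apply (by fun_prop) MeasurableSet.univ, Set.preimage_univ]
    exact h3.trans (by gcongr; exact min_le_left _ _)
  · rw [eLpNorm_map_measure (by fun_prop) (by fun_prop)]
    refine (eLpNorm_le_mul_eLpNorm_of_ae_le_mul (c := c)
      (Filter.Eventually.of_forall fun z : E × E ↦ hfc z.1 z.2) 2).trans ?_
    refine (mul_le_mul_right h4 _).trans ?_
    rw [mul_add]
    gcongr
    calc ENNReal.ofReal c * δ ≤ ENNReal.ofReal c * (ε / ENNReal.ofReal c) := by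
          gcongr; exact min_le_right _ _
      _ = ε := ENNReal.mul_div_cancel hc' ENNReal.ofReal_ne_top

lemma PartialTransport.symm {μ ν : Measure E} {a η : ℝ≥0∞} (h : PartialTransport μ ν a η)
    [BorelSpace E] [SecondCountableTopology E] :
    PartialTransport ν μ a η := by
  obtain ⟨γ, h1, h2, h3, h4⟩ := h
  refine ⟨γ.map Prod.swap, ?_, ?_, ?_, ?_⟩
  · rw [Measure.map_map measurable_fst measurable_swap]; exact h2
  · rw [Measure.map_map measurable_snd measurable_swap]; exact h1
  · rwa [Measure.map_apply measurable_swap MeasurableSet.univ, Set.preimage_univ]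
  · rw [eLpNorm_map_measure (by fun_prop) (by fun_prop)]
    refine le_trans (le_of_eq ?_) h4
    rw [← eLpNorm_neg]
    congr 1
    ext z
    simp

variable [BorelSpace E] [SecondCountableTopology E]

lemma partialTransport_map {Ω : Type*} [MeasurableSpace Ω] (P : Measure Ω)
    [IsProbabilityMeasure P] {X Y : Ω → E} (hX : Measurable X) (hY : Measurable Y) :
    PartialTransport (P.map X) (P.map Y) (eLpNorm (fun ω ↦ X ω - Y ω) 2 P) 0 := by
  refine ⟨P.map (fun ω ↦ (X ω, Y ω)), ?_, ?_, ?_, ?_⟩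
  · rw [Measure.map_map measurable_fst (by fun_prop)]; rfl
  · rw [Measure.map_map measurable_snd (by fun_prop)]; rfl
  · rw [Measure.map_apply (by fun_prop) MeasurableSet.univ]; simp
  · rw [eLpNorm_map_measure (by fun_prop) (by fun_prop)]; rfl

/-- The common part of the two measures stays in place, on the diagonal; a total variation bound
thus costs only mass. A one-sided inequality suffices because both measures have mass one. -/
lemma partialTransport_of_measure_le {μ ν : Measure E} [IsProbabilityMeasure μ]
    [IsProbabilityMeasure ν] {η : ℝ≥0∞} (h : ∀ s, MeasurableSet s → μ s ≤ ν s + η) :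
    PartialTransport μ ν 0 η := by
  obtain ⟨m, s, hs, h1, h2, h3⟩ := exists_common_le_measure μ ν
  refine ⟨m.map (fun x ↦ (x, x)), ?_, ?_, ?_, ?_⟩
  · rw [Measure.map_map measurable_fst (by fun_prop)]
    exact (Measure.map_id (μ := m)).le.trans h1
  · rw [Measure.map_map measurable_snd (by fun_prop)]
    exact (Measure.map_id (μ := m)).le.trans h2
  · rw [Measure.map_apply (by fun_prop) MeasurableSet.univ, Set.preimage_univ, h3,
      ← measure_univ (μ := μ), ← measure_add_measure_compl hs]
    calc μ s + μ sᶜ ≤ (ν s + η) + μ sᶜ := by gcongr; exact h s hs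
      _ = _ := by ring
  · rw [eLpNorm_map_measure (by fun_prop) (by fun_prop)]
    refine le_of_eq ?_
    convert eLpNorm_zero (μ := m) (p := 2) (ε := E) using 2
    ext x
    simp

/-- Gluing along the middle measure. The two plans may use different parts of `ν`, so the
conditional laws are glued over the minimum of their middle marginals. Each marginal misses at most
its own tolerance of `ν`, hence the missing masses add; the costs add by Minkowski's inequality. -/
lemma PartialTransport.trans [StandardBorelSpace E] {μ ν ρ : Measure E}
    [IsProbabilityMeasure μ] [IsProbabilityMeasure ν] [IsProbabilityMeasure ρ]
    {a b η θ : ℝ≥0∞} (h : PartialTransport μ ν a η) (h' : PartialTransport ν ρ b θ) :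
    PartialTransport μ ρ (a + b) (η + θ) := by
  obtain ⟨γ₁, h1, h2, h3, h4⟩ := h.symm
  obtain ⟨γ₂, k1, k2, k3, k4⟩ := h'
  have : IsFiniteMeasure γ₁ := isFiniteMeasure_of_map_le measurable_fst h1
  have : IsFiniteMeasure γ₂ := isFiniteMeasure_of_map_le measurable_fst k1
  have d1 : γ₁.fst ⊗ₘ γ₁.condKernel = γ₁ := Measure.disintegrate _ _
  have d2 : γ₂.fst ⊗ₘ γ₂.condKernel = γ₂ := Measure.disintegrate _ _
  obtain ⟨m, s, hs, m1, m2, m3⟩ := exists_common_le_measure γ₁.fst γ₂.fst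
  have hm : IsFiniteMeasure m := isFiniteMeasure_of_le _ m1
  -- The first coordinate of `π` is the middle point; the two endpoints are conditionally
  -- independent given it.
  set π := m ⊗ₘ (γ₁.condKernel ×ₖ γ₂.condKernel) with hπ
  have e1 : π.map (Prod.map id Prod.fst) ≤ γ₁ := by
    rw [hπ, ← Measure.compProd_map measurable_fst, ← Kernel.fst_eq, Kernel.fst_prod]
    exact (compProd_mono_left m1 _).trans d1.le
  have e2 : π.map (Prod.map id Prod.snd) ≤ γ₂ := by
    rw [hπ, ← Measure.compProd_map measurable_snd, ← Kernel.snd_eq, Kernel.snd_prod]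
    exact (compProd_mono_left m2 _).trans d2.le
  refine ⟨π.map Prod.snd, ?_, ?_, ?_, ?_⟩
  · rw [Measure.map_map measurable_fst measurable_snd]
    refine le_trans (le_of_eq ?_) ((Measure.map_mono e1 measurable_snd).trans h2)
    rw [Measure.map_map measurable_snd (by fun_prop)]; rfl
  · rw [Measure.map_map measurable_snd measurable_snd]
    refine le_trans (le_of_eq ?_) ((Measure.map_mono e2 measurable_snd).trans k2)
    rw [Measure.map_map measurable_snd (by fun_prop)]; rfl
  · have hπu : π.map Prod.snd Set.univ = m Set.univ := by
      rw [Measure.map_apply measurable_snd MeasurableSet.univ, Set.preimage_univ, hπ,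
        Measure.compProd_apply MeasurableSet.univ]
      simp
    rw [hπu, m3]
    have q1 := measure_le_add_of_le (ν := ν) (μ := γ₁.fst) (η := η) h1
      (by rwa [Measure.fst_univ]) hs.compl
    have q2 := measure_le_add_of_le (ν := ν) (μ := γ₂.fst) (η := θ) k1
      (by rwa [Measure.fst_univ]) hs
    calc (1 : ℝ≥0∞) = ν s + ν sᶜ := by rw [measure_add_measure_compl hs, measure_univ]
      _ ≤ (γ₂.fst s + θ) + (γ₁.fst sᶜ + η) := by gcongr
      _ = _ := by ring
  · rw [eLpNorm_map_measure (by fun_prop) (by fun_prop)]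
    have f1 : eLpNorm (fun w : E × E × E ↦ w.2.1 - w.1) 2 π ≤ a := by
      refine le_trans ?_ h4
      refine le_trans (le_of_eq ?_) (eLpNorm_mono_measure _ e1)
      rw [eLpNorm_map_measure (by fun_prop) (by fun_prop), ← eLpNorm_neg]
      congr 1
      ext w
      simp
    have f2 : eLpNorm (fun w : E × E × E ↦ w.1 - w.2.2) 2 π ≤ b := by
      refine le_trans ?_ k4
      refine le_trans (le_of_eq ?_) (eLpNorm_mono_measure _ e2)
      rw [eLpNorm_map_measure (by fun_prop) (by fun_prop)]
      rfl
    calc _ = eLpNorm ((fun w : E × E × E ↦ w.2.1 - w.1) + (fun w ↦ w.1 - w.2.2)) 2 π := by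
          congr 1; ext w; simp
      _ ≤ _ := eLpNorm_add_le (by fun_prop) (by fun_prop) (by norm_num)
      _ ≤ a + b := by gcongr

lemma NearTransport.trans [StandardBorelSpace E] {μ ν ρ : Measure E}
    [IsProbabilityMeasure μ] [IsProbabilityMeasure ν] [IsProbabilityMeasure ρ]
    {a b : ℝ≥0∞} (h : NearTransport μ ν a) (h' : NearTransport ν ρ b) :
    NearTransport μ ρ (a + b) := by
  intro ε hε
  have hε2 : 0 < ε / 2 := ENNReal.half_pos hε.ne'
  refine ((h _ hε2).trans (h' _ hε2)).mono (le_of_eq ?_) (le_of_eq (ENNReal.add_halves ε))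
  rw [add_add_add_comm, ENNReal.add_halves]

lemma NearTransport.symm {μ ν : Measure E} {a : ℝ≥0∞} (h : NearTransport μ ν a) :
    NearTransport ν μ a := fun ε hε ↦ (h ε hε).symm

lemma nearTransport_map {Ω : Type*} [MeasurableSpace Ω] (P : Measure Ω)
    [IsProbabilityMeasure P] {X Y : Ω → E} (hX : Measurable X) (hY : Measurable Y) :
    NearTransport (P.map X) (P.map Y) (eLpNorm (fun ω ↦ X ω - Y ω) 2 P) :=
  fun _ _ ↦ (partialTransport_map P hX hY).mono le_self_add zero_le

/-- The same independent displacement with law `ρ` is added to both ends of the plan, so differences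
do not change. -/
lemma NearTransport.conv {μ ν ρ : Measure E} [IsProbabilityMeasure μ] [IsProbabilityMeasure ν]
    [IsProbabilityMeasure ρ] {a : ℝ≥0∞} (h : NearTransport μ ν a) :
    NearTransport (μ ∗ ρ) (ν ∗ ρ) a := by
  intro ε hε
  obtain ⟨γ, h1, h2, h3, h4⟩ := h ε hε
  have : IsFiniteMeasure γ := isFiniteMeasure_of_map_le measurable_fst h1
  refine ⟨(γ.prod ρ).map (fun w ↦ (w.1.1 + w.2, w.1.2 + w.2)), ?_, ?_, ?_, ?_⟩
  · rw [Measure.map_map measurable_fst (by fun_prop), Measure.conv]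
    refine le_trans (le_of_eq ?_)
      (Measure.map_mono (Measure.prod_mono h1 (le_refl ρ)) measurable_add)
    nth_rw 2 [← Measure.map_id (μ := ρ)]
    rw [Measure.map_prod_map _ _ measurable_fst measurable_id,
      Measure.map_map measurable_add (by fun_prop)]
    rfl
  · rw [Measure.map_map measurable_snd (by fun_prop), Measure.conv]
    refine le_trans (le_of_eq ?_)
      (Measure.map_mono (Measure.prod_mono h2 (le_refl ρ)) measurable_add)
    nth_rw 2 [← Measure.map_id (μ := ρ)]
    rw [Measure.map_prod_map _ _ measurable_snd measurable_id,
      Measure.map_map measurable_add (by fun_prop)]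
    rfl
  · rw [Measure.map_apply (by fun_prop) MeasurableSet.univ, Set.preimage_univ]
    rw [← Set.univ_prod_univ, Measure.prod_prod, measure_univ (μ := ρ), mul_one]
    exact h3
  · rw [eLpNorm_map_measure (by fun_prop) (by fun_prop)]
    refine le_trans (le_of_eq ?_) h4
    have : γ = (γ.prod ρ).map Prod.fst := by
      rw [Measure.map_fst_prod, measure_univ, one_smul]
    rw [this, eLpNorm_map_measure (by fun_prop) (by fun_prop), ← this]
    congr 1
    ext w
    simp

end Generic

/-! ### From partial plans to the transportation distance -/

/-- Uniform integrability over all measures dominated by `μ`: where `f` is at least `K`, absolute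
continuity of the integral against `μ` applies; elsewhere the integral is at most `K` times the
mass. -/
lemma exists_forall_lintegral_le_of_measure_univ_le {α : Type*} [MeasurableSpace α]
    {μ : Measure α} {f : α → ℝ≥0∞} (hf : Measurable f) (hfi : ∫⁻ x, f x ∂μ ≠ ∞)
    {ε : ℝ≥0∞} (hε : ε ≠ 0) :
    ∃ δ : ℝ≥0∞, 0 < δ ∧ ∀ μ' ≤ μ, μ' Set.univ ≤ δ → ∫⁻ x, f x ∂μ' ≤ ε := by
  have hε2 : ε / 2 ≠ 0 := (ENNReal.half_pos hε).ne'
  obtain ⟨δ, hδ, hδ'⟩ := exists_pos_setLIntegral_lt_of_measure_lt hfi hε2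
  obtain ⟨K, hK⟩ : ∃ K : ℕ, (∫⁻ x, f x ∂μ) / δ < K :=
    ENNReal.exists_nat_gt (ENNReal.div_ne_top hfi hδ.ne')
  have hK0 : (K : ℝ≥0∞) ≠ 0 := (zero_le.trans_lt hK).ne'
  set s := {x | (K : ℝ≥0∞) ≤ f x} with hs
  have hsm : MeasurableSet s := measurableSet_le measurable_const hf
  have hμs : μ s < δ := by
    refine lt_of_le_of_lt (meas_ge_le_lintegral_div hf.aemeasurable hK0 (by simp)) ?_
    rw [ENNReal.div_lt_iff (Or.inl hK0) (Or.inl (by simp)), mul_comm]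
    by_cases hδt : δ = ∞
    · rw [hδt, ENNReal.mul_top hK0]; exact lt_top_iff_ne_top.2 hfi
    · exact (ENNReal.div_lt_iff (Or.inl hδ.ne') (Or.inl hδt)).1 hK
  refine ⟨ε / 2 / K, ENNReal.div_pos hε2 (by simp), fun μ' hμ' hu ↦ ?_⟩
  rw [← lintegral_add_compl f hsm, ← ENNReal.add_halves ε]
  gcongr
  · exact (lintegral_mono' (Measure.restrict_mono le_rfl hμ') le_rfl).trans (hδ' s hμs).le
  · calc ∫⁻ x in sᶜ, f x ∂μ' ≤ ∫⁻ x in sᶜ, K ∂μ' := by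
          refine setLIntegral_mono measurable_const fun x hx ↦ ?_
          exact (not_le.1 (show ¬ (K : ℝ≥0∞) ≤ f x from hx)).le
      _ ≤ K * μ' Set.univ := by
          rw [setLIntegral_const]; gcongr; exact Set.subset_univ _
      _ ≤ K * (ε / 2 / K) := by gcongr
      _ = ε / 2 := ENNReal.mul_div_cancel hK0 (by simp)

/-- The two unused marginals have the same mass, so their normalised product completes the plan to a
coupling. -/
lemma exists_coupling_of_partial {E : Type*} [MeasurableSpace E] {μ ν : Measure E}
    [IsProbabilityMeasure μ] [IsProbabilityMeasure ν] {γ : Measure (E × E)}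
    (h1 : γ.map Prod.fst ≤ μ) (h2 : γ.map Prod.snd ≤ ν) :
    ∃ (π : Measure (E × E)) (μ' ν' : Measure E), γ + π ∈ couplings μ ν ∧ π.map Prod.fst = μ' ∧
      π.map Prod.snd = ν' ∧ μ' ≤ μ ∧ ν' ≤ ν ∧ μ' Set.univ = 1 - γ Set.univ ∧
      ν' Set.univ = 1 - γ Set.univ := by
  have hγ : IsFiniteMeasure γ := isFiniteMeasure_of_map_le measurable_fst h1
  have hu1 : (μ - γ.map Prod.fst) Set.univ = 1 - γ Set.univ := by
    rw [Measure.sub_apply MeasurableSet.univ h1, measure_univ,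
      Measure.map_apply measurable_fst MeasurableSet.univ, Set.preimage_univ]
  have hu2 : (ν - γ.map Prod.snd) Set.univ = 1 - γ Set.univ := by
    rw [Measure.sub_apply MeasurableSet.univ h2, measure_univ,
      Measure.map_apply measurable_snd MeasurableSet.univ, Set.preimage_univ]
  have key : ∃ π : Measure (E × E), π.map Prod.fst = μ - γ.map Prod.fst ∧
      π.map Prod.snd = ν - γ.map Prod.snd := by
    by_cases h0 : 1 - γ Set.univ = 0
    · refine ⟨0, ?_, ?_⟩
      · rw [h0] at hu1; rw [Measure.measure_univ_eq_zero.1 hu1]; simp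
      · rw [h0] at hu2; rw [Measure.measure_univ_eq_zero.1 hu2]; simp
    · have ht : 1 - γ Set.univ ≠ ∞ := by simp
      refine ⟨(1 - γ Set.univ)⁻¹ • ((μ - γ.map Prod.fst).prod (ν - γ.map Prod.snd)), ?_, ?_⟩
      · rw [Measure.map_smul, Measure.map_fst_prod, hu2, smul_smul,
          ENNReal.inv_mul_cancel h0 ht, one_smul]
      · rw [Measure.map_smul, Measure.map_snd_prod, hu1, smul_smul,
          ENNReal.inv_mul_cancel h0 ht, one_smul]
  obtain ⟨π, p1, p2⟩ := key
  have m1 : (γ + π).map Prod.fst = μ := by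
    rw [Measure.map_add _ _ measurable_fst, p1, add_comm, Measure.sub_add_cancel_of_le h1]
  have m2 : (γ + π).map Prod.snd = ν := by
    rw [Measure.map_add _ _ measurable_snd, p2, add_comm, Measure.sub_add_cancel_of_le h2]
  refine ⟨π, _, _, ⟨⟨?_⟩, m1, m2⟩, p1, p2, Measure.sub_le, Measure.sub_le, hu1, hu2⟩
  rw [← measure_univ (μ := μ), ← m1, Measure.map_apply measurable_fst MeasurableSet.univ,
    Set.preimage_univ]

/-- Partial transport plans missing arbitrarily little mass bound the transportation distance. -/
lemma NearTransport.transportDist_le {E : Type*} [NormedAddCommGroup E] [MeasurableSpace E]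
    [BorelSpace E] [SecondCountableTopology E] {μ ν : Measure E}
    [IsProbabilityMeasure μ] [IsProbabilityMeasure ν] {a : ℝ≥0∞}
    (h : NearTransport μ ν a) (hμ : ∫⁻ x, ‖x‖ₑ ^ (2 : ℝ) ∂μ ≠ ∞)
    (hν : ∫⁻ x, ‖x‖ₑ ^ (2 : ℝ) ∂ν ≠ ∞) : transportDist 2 μ ν ≤ a := by
  have hm : Measurable fun x : E ↦ ‖x‖ₑ ^ (2 : ℝ) := by fun_prop
  -- The term `4 * ε` pays for the completing part of the coupling: ‖x - y‖² ≤ 2‖x‖² + 2‖y‖², and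
  -- each leftover marginal has second moment at most ε.
  have key : ∀ ε : ℝ≥0∞, 0 < ε → ⨅ γ ∈ couplings μ ν, ∫⁻ z, ‖z.1 - z.2‖ₑ ^ (2 : ℝ) ∂γ ≤
      (a + ε) ^ (2 : ℝ) + 4 * ε := by
    intro ε hε
    obtain ⟨δ₁, hδ₁, H₁⟩ := exists_forall_lintegral_le_of_measure_univ_le hm hμ hε.ne'
    obtain ⟨δ₂, hδ₂, H₂⟩ := exists_forall_lintegral_le_of_measure_univ_le hm hν hε.ne'
    set δ := min ε (min δ₁ δ₂) with hδ
    have hδ0 : 0 < δ := lt_min hε (lt_min hδ₁ hδ₂)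
    have hδε : δ ≤ ε := min_le_left _ _
    obtain ⟨γ, h1, h2, h3, h4⟩ := h δ hδ0
    obtain ⟨π, μ', ν', hc, p1, p2, q1, q2, u1, u2⟩ := exists_coupling_of_partial h1 h2
    have hu : 1 - γ Set.univ ≤ δ := tsub_le_iff_left.2 h3
    have c1 := H₁ μ' q1 (u1.le.trans (hu.trans ((min_le_right _ _).trans (min_le_left _ _))))
    have c2 := H₂ ν' q2 (u2.le.trans (hu.trans ((min_le_right _ _).trans (min_le_right _ _))))
    refine (iInf₂_le (γ + π) hc).trans ?_
    rw [lintegral_add_measure]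
    refine add_le_add ?_ ?_
    · rw [eLpNorm_eq_lintegral_rpow_enorm_toReal (by norm_num) (by norm_num)] at h4
      have h5 : (∫⁻ z, ‖z.1 - z.2‖ₑ ^ (2 : ℝ) ∂γ) ^ (1 / 2 : ℝ) ≤ a + δ := by
        simpa using h4
      calc _ = ((∫⁻ z, ‖z.1 - z.2‖ₑ ^ (2 : ℝ) ∂γ) ^ (1 / 2 : ℝ)) ^ (2 : ℝ) := by
            rw [← ENNReal.rpow_mul]; norm_num
        _ ≤ (a + δ) ^ (2 : ℝ) := by gcongr
        _ ≤ _ := by gcongr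
    · rw [← p1, lintegral_map hm measurable_fst] at c1
      rw [← p2, lintegral_map hm measurable_snd] at c2
      have hle : ∀ z : E × E, ‖z.1 - z.2‖ₑ ^ (2 : ℝ) ≤
          2 * ‖z.1‖ₑ ^ (2 : ℝ) + 2 * ‖z.2‖ₑ ^ (2 : ℝ) := by
        intro z
        have e1 : ‖z.1 - z.2‖ₑ ≤ ‖z.1‖ₑ + ‖z.2‖ₑ := enorm_sub_le
        calc _ ≤ (‖z.1‖ₑ + ‖z.2‖ₑ) ^ (2 : ℝ) := by gcongr
          _ ≤ (2 : ℝ≥0∞) ^ ((2 : ℝ) - 1) * (‖z.1‖ₑ ^ (2 : ℝ) + ‖z.2‖ₑ ^ (2 : ℝ)) :=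
            ENNReal.rpow_add_le_mul_rpow_add_rpow _ _ (by norm_num)
          _ = _ := by norm_num [mul_add]
      calc _ ≤ ∫⁻ z, (2 * ‖z.1‖ₑ ^ (2 : ℝ) + 2 * ‖z.2‖ₑ ^ (2 : ℝ)) ∂π :=
            lintegral_mono hle
        _ = 2 * ∫⁻ z, ‖z.1‖ₑ ^ (2 : ℝ) ∂π + 2 * ∫⁻ z, ‖z.2‖ₑ ^ (2 : ℝ) ∂π := by
            rw [lintegral_add_left (by fun_prop), lintegral_const_mul _ (by fun_prop),
              lintegral_const_mul _ (by fun_prop)]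
        _ ≤ 2 * ε + 2 * ε := by gcongr
        _ = 4 * ε := by rw [← add_mul]; norm_num
  have hinf : ⨅ γ ∈ couplings μ ν, ∫⁻ z, ‖z.1 - z.2‖ₑ ^ (2 : ℝ) ∂γ ≤ a ^ (2 : ℝ) := by
    have hc : Continuous fun ε : ℝ≥0∞ ↦ (a + ε) ^ (2 : ℝ) + 4 * ε :=
      ((ENNReal.continuous_rpow_const).comp (continuous_const.add continuous_id)).add
        (ENNReal.continuous_const_mul (by norm_num))
    have ht := (hc.tendsto 0).mono_left (nhdsWithin_le_nhds (s := Set.Ioi 0))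
    rw [add_zero, mul_zero, add_zero] at ht
    refine ge_of_tendsto ht ?_
    filter_upwards [self_mem_nhdsWithin] with ε hε using key ε hε
  unfold transportDist
  calc _ ≤ (a ^ (2 : ℝ)) ^ (1 / 2 : ℝ) := by gcongr
    _ = a := by rw [← ENNReal.rpow_mul]; norm_num

/-! ### Integrals carried together with integrability -/

/-- The function `f` is integrable with integral `v`. -/
def HasIntegral {α V : Type*} [MeasurableSpace α] [NormedAddCommGroup V] [NormedSpace ℝ V]
    (μ : Measure α) (f : α → V) (v : V) : Prop :=
  Integrable f μ ∧ ∫ x, f x ∂μ = v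

section HasIntegral

variable {α V : Type*} [MeasurableSpace α] [NormedAddCommGroup V] [NormedSpace ℝ V]
  {μ : Measure α} {f g : α → V} {v w : V}

lemma HasIntegral.add (hf : HasIntegral μ f v) (hg : HasIntegral μ g w) :
    HasIntegral μ (fun x ↦ f x + g x) (v + w) :=
  ⟨hf.1.add hg.1, by rw [integral_add hf.1 hg.1, hf.2, hg.2]⟩

lemma HasIntegral.sub (hf : HasIntegral μ f v) (hg : HasIntegral μ g w) :
    HasIntegral μ (fun x ↦ f x - g x) (v - w) :=
  ⟨hf.1.sub hg.1, by rw [integral_sub hf.1 hg.1, hf.2, hg.2]⟩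

lemma HasIntegral.const_smul (c : ℝ) (hf : HasIntegral μ f v) :
    HasIntegral μ (fun x ↦ c • f x) (c • v) :=
  ⟨hf.1.smul c, by rw [integral_smul, hf.2]⟩

lemma HasIntegral.const_mul {f : α → ℝ} {v : ℝ} (c : ℝ) (hf : HasIntegral μ f v) :
    HasIntegral μ (fun x ↦ c * f x) (c * v) := hf.const_smul c

lemma HasIntegral.const_inner {V : Type*} [NormedAddCommGroup V] [InnerProductSpace ℝ V]
    [CompleteSpace V] {f : α → V} {v : V} (c : V) (hf : HasIntegral μ f v) :
    HasIntegral μ (fun x ↦ inner ℝ c (f x)) (inner ℝ c v) :=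
  ⟨hf.1.const_inner c, by rw [integral_inner hf.1, hf.2]⟩

lemma hasIntegral_const [CompleteSpace V] [IsProbabilityMeasure μ] (v : V) : HasIntegral μ (fun _ ↦ v) v :=
  ⟨integrable_const v, by simp⟩

lemma hasIntegral_finsetSum {ι : Type*} (s : Finset ι) {f : ι → α → V} {v : ι → V}
    (h : ∀ i ∈ s, HasIntegral μ (f i) (v i)) :
    HasIntegral μ (fun x ↦ ∑ i ∈ s, f i x) (∑ i ∈ s, v i) :=
  ⟨integrable_finsetSum s fun i hi ↦ (h i hi).1, by
    rw [integral_finsetSum s fun i hi ↦ (h i hi).1]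
    exact Finset.sum_congr rfl fun i hi ↦ (h i hi).2⟩

lemma HasIntegral.congr (hf : HasIntegral μ f v) (h : ∀ x, f x = g x) (hv : v = w) :
    HasIntegral μ g w := by
  obtain rfl : f = g := funext h
  rwa [← hv]

end HasIntegral

/-! ### Shifts of the standard Gaussian and moments of their densities -/

/-- The diagonal operator with entries `f`. -/
noncomputable def diagMap {d : ℕ} (f : Fin d → ℝ) :
    EuclideanSpace ℝ (Fin d) →L[ℝ] EuclideanSpace ℝ (Fin d) :=
  LinearMap.toContinuousLinearMap
    { toFun := fun x ↦ WithLp.toLp 2 (fun j ↦ f j * x j)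
      map_add' := fun x y ↦ by ext j; simp [mul_add]
      map_smul' := fun c x ↦ by ext j; simp [mul_left_comm] }

@[simp]
lemma diagMap_apply {d : ℕ} (f : Fin d → ℝ) (x : EuclideanSpace ℝ (Fin d)) (j : Fin d) :
    diagMap f x j = f j * x j := rfl

/-- The density of the shift by `a` of the standard Gaussian measure. -/
noncomputable def gaussTilt {d : ℕ} (a ξ : EuclideanSpace ℝ (Fin d)) : ℝ :=
  Real.exp (inner ℝ a ξ - ‖a‖ ^ 2 / 2)

/-- The second order remainder of `gaussTilt a` at `a = 0`. -/
noncomputable def gaussRem {d : ℕ} (a ξ : EuclideanSpace ℝ (Fin d)) : ℝ :=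
  gaussTilt a ξ - 1 - inner ℝ a ξ

section Gauss

variable {d : ℕ}

lemma gaussTilt_pos (a ξ : EuclideanSpace ℝ (Fin d)) : 0 < gaussTilt a ξ := Real.exp_pos _

@[fun_prop]
lemma measurable_gaussTilt {α : Type*} [MeasurableSpace α] {f g : α → EuclideanSpace ℝ (Fin d)}
    (hf : Measurable f) (hg : Measurable g) : Measurable fun x ↦ gaussTilt (f x) (g x) := by
  unfold gaussTilt; fun_prop

@[fun_prop]
lemma measurable_gaussRem {α : Type*} [MeasurableSpace α] {f g : α → EuclideanSpace ℝ (Fin d)}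
    (hf : Measurable f) (hg : Measurable g) : Measurable fun x ↦ gaussRem (f x) (g x) := by
  unfold gaussRem; fun_prop

lemma gaussTilt_mul_gaussTilt (a b ξ : EuclideanSpace ℝ (Fin d)) :
    gaussTilt a ξ * gaussTilt b ξ = Real.exp (inner ℝ a b) * gaussTilt (a + b) ξ := by
  unfold gaussTilt
  rw [← Real.exp_add, ← Real.exp_add, norm_add_sq_real, inner_add_left]
  congr 1
  ring

/-- Fernique's theorem gives a Gaussian exponential moment, and completing the square absorbs the
linear exponent. -/
lemma integrable_exp_mul_norm (b : ℝ) :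
    Integrable (fun ξ ↦ Real.exp (b * ‖ξ‖)) (stdGaussian (EuclideanSpace ℝ (Fin d))) := by
  obtain ⟨C, hC, hi⟩ := IsGaussian.exists_integrable_exp_sq (stdGaussian (EuclideanSpace ℝ (Fin d)))
  refine (hi.const_mul (Real.exp (b ^ 2 / (4 * C)))).mono' (by fun_prop)
    (Filter.Eventually.of_forall fun ξ ↦ ?_)
  rw [Real.norm_eq_abs, Real.abs_exp, ← Real.exp_add]
  gcongr
  have h : b ^ 2 / (4 * C) + C * ‖ξ‖ ^ 2 - b * ‖ξ‖ = C * (‖ξ‖ - b / (2 * C)) ^ 2 := by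
    field_simp; ring
  have : 0 ≤ C * (‖ξ‖ - b / (2 * C)) ^ 2 := by positivity
  linarith

lemma integrable_of_norm_le_exp {V : Type*} [NormedAddCommGroup V]
    {f : EuclideanSpace ℝ (Fin d) → V}
    (hf : AEStronglyMeasurable f (stdGaussian (EuclideanSpace ℝ (Fin d)))) {C b : ℝ}
    (h : ∀ ξ, ‖f ξ‖ ≤ C * Real.exp (b * ‖ξ‖)) :
    Integrable f (stdGaussian (EuclideanSpace ℝ (Fin d))) :=
  ((integrable_exp_mul_norm b).const_mul C).mono' hf (Filter.Eventually.of_forall h)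

lemma gaussTilt_le (a ξ : EuclideanSpace ℝ (Fin d)) : gaussTilt a ξ ≤ Real.exp (‖a‖ * ‖ξ‖) := by
  unfold gaussTilt
  gcongr
  have := real_inner_le_norm a ξ
  have : 0 ≤ ‖a‖ ^ 2 / 2 := by positivity
  linarith

lemma integrable_gaussTilt (a : EuclideanSpace ℝ (Fin d)) :
    Integrable (gaussTilt a) (stdGaussian (EuclideanSpace ℝ (Fin d))) := by
  refine integrable_of_norm_le_exp (C := 1) (b := ‖a‖)
    (Measurable.aestronglyMeasurable (by unfold gaussTilt; fun_prop)) fun ξ ↦ ?_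
  rw [one_mul, Real.norm_of_nonneg (gaussTilt_pos a ξ).le]
  exact gaussTilt_le a ξ

/-- Complex coefficients are needed: the characteristic function of a tilted Gaussian mixes a real
tilt with an imaginary frequency. -/
lemma integral_cexp_stdGaussian (z : Fin d → ℂ) :
    ∫ ξ : EuclideanSpace ℝ (Fin d), Complex.exp (∑ j, z j * (ξ j : ℂ))
      ∂(stdGaussian (EuclideanSpace ℝ (Fin d))) = Complex.exp (∑ j, z j ^ 2 / 2) := by
  rw [← map_pi_eq_stdGaussian, ← MeasurableEquiv.coe_toLp,
    (MeasurableEquiv.toLp 2 _).measurableEmbedding.integral_map]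
  simp only [MeasurableEquiv.coe_toLp, Complex.exp_sum]
  rw [integral_fintype_prod_eq_prod (f := fun j (x : ℝ) ↦ Complex.exp (z j * (x : ℂ)))]
  refine Finset.prod_congr rfl fun j _ ↦ ?_
  have := complexMGF_id_gaussianReal (μ := 0) (v := 1) (z j)
  simpa [complexMGF] using this

/-- The Cameron–Martin formula, checked on characteristic functions. -/
lemma map_add_stdGaussian (a : EuclideanSpace ℝ (Fin d)) :
    (stdGaussian (EuclideanSpace ℝ (Fin d))).map (fun ξ ↦ ξ + a) =
      (stdGaussian (EuclideanSpace ℝ (Fin d))).withDensity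
        (fun ξ ↦ ENNReal.ofReal (gaussTilt a ξ)) := by
  have hfin : IsFiniteMeasure ((stdGaussian (EuclideanSpace ℝ (Fin d))).withDensity
      (fun ξ ↦ ENNReal.ofReal (gaussTilt a ξ))) :=
    isFiniteMeasure_withDensity_ofReal (integrable_gaussTilt a).2
  have hprob : IsProbabilityMeasure ((stdGaussian (EuclideanSpace ℝ (Fin d))).map
      (fun ξ ↦ ξ + a)) := Measure.isProbabilityMeasure_map (by fun_prop)
  refine Measure.ext_of_charFun (funext fun t ↦ ?_)
  rw [charFun_map_add_const, charFun_stdGaussian, charFun_apply,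
    integral_withDensity_eq_integral_toReal_smul (by fun_prop)
      (Filter.Eventually.of_forall fun _ ↦ ENNReal.ofReal_lt_top)]
  have h : ∀ ξ : EuclideanSpace ℝ (Fin d), (ENNReal.ofReal (gaussTilt a ξ)).toReal •
      Complex.exp ((inner ℝ ξ t : ℝ) * Complex.I) = Complex.exp (-((‖a‖ ^ 2 / 2 : ℝ) : ℂ)) *
        Complex.exp (∑ j, ((a j : ℂ) + (t j : ℂ) * Complex.I) * (ξ j : ℂ)) := by
    intro ξ
    rw [ENNReal.toReal_ofReal (gaussTilt_pos a ξ).le, gaussTilt, Complex.real_smul,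
      Complex.ofReal_exp, ← Complex.exp_add, ← Complex.exp_add]
    congr 1
    simp only [PiLp.inner_apply, RCLike.inner_apply, conj_trivial, add_mul, Finset.sum_add_distrib]
    push_cast
    simp only [Finset.sum_mul]
    have e : ∀ j, (t j : ℂ) * Complex.I * (ξ j : ℂ) = (t j : ℂ) * (ξ j : ℂ) * Complex.I :=
      fun j ↦ by ring
    have e' : ∀ j, (a j : ℂ) * (ξ j : ℂ) = (ξ j : ℂ) * (a j : ℂ) := fun j ↦ by ring
    simp only [e, e']
    ring
  simp_rw [h]
  rw [integral_const_mul, integral_cexp_stdGaussian, ← Complex.exp_add, ← Complex.exp_add]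
  congr 1
  rw [EuclideanSpace.real_norm_sq_eq]
  have hn : ((‖t‖ : ℂ)) ^ 2 = ∑ j, (t j : ℂ) ^ 2 := by
    rw [← Complex.ofReal_pow, EuclideanSpace.real_norm_sq_eq]; push_cast; rfl
  rw [hn]
  simp only [PiLp.inner_apply, RCLike.inner_apply, conj_trivial]
  push_cast
  simp only [Finset.sum_mul, Finset.sum_div, ← Finset.sum_neg_distrib, ← Finset.sum_add_distrib]
  refine Finset.sum_congr rfl fun j _ ↦ ?_
  linear_combination (-(t j : ℂ) ^ 2 / 2) * Complex.I_sq

lemma lintegral_add_stdGaussian (a : EuclideanSpace ℝ (Fin d))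
    {f : EuclideanSpace ℝ (Fin d) → ℝ≥0∞} (hf : Measurable f) :
    ∫⁻ ξ, f (ξ + a) ∂(stdGaussian (EuclideanSpace ℝ (Fin d))) =
      ∫⁻ ξ, ENNReal.ofReal (gaussTilt a ξ) * f ξ ∂(stdGaussian (EuclideanSpace ℝ (Fin d))) := by
  rw [← lintegral_map (f := f) hf (measurable_add_const a), map_add_stdGaussian,
    lintegral_withDensity_eq_lintegral_mul _ (by fun_prop) hf]
  rfl

lemma integral_add_stdGaussian {V : Type*} [NormedAddCommGroup V] [NormedSpace ℝ V]
    (a : EuclideanSpace ℝ (Fin d)) (f : EuclideanSpace ℝ (Fin d) → V) :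
    ∫ ξ, gaussTilt a ξ • f ξ ∂(stdGaussian (EuclideanSpace ℝ (Fin d))) =
      ∫ ξ, f (ξ + a) ∂(stdGaussian (EuclideanSpace ℝ (Fin d))) := by
  rw [← (measurableEmbedding_addRight a).integral_map, map_add_stdGaussian,
    integral_withDensity_eq_integral_toReal_smul (by fun_prop)
      (Filter.Eventually.of_forall fun _ ↦ ENNReal.ofReal_lt_top)]
  simp_rw [ENNReal.toReal_ofReal (gaussTilt_pos a _).le]

/-- Every moment containing a tilt is evaluated by trading the tilt for a shift of the argument. -/
lemma hasIntegral_gaussTilt_smul {V : Type*} [NormedAddCommGroup V] [NormedSpace ℝ V]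
    (a : EuclideanSpace ℝ (Fin d)) {f : EuclideanSpace ℝ (Fin d) → V} {v : V}
    (h : HasIntegral (stdGaussian (EuclideanSpace ℝ (Fin d))) (fun ξ ↦ f (ξ + a)) v) :
    HasIntegral (stdGaussian (EuclideanSpace ℝ (Fin d))) (fun ξ ↦ gaussTilt a ξ • f ξ) v := by
  refine ⟨?_, by rw [integral_add_stdGaussian, h.2]⟩
  have h' : Integrable f ((stdGaussian (EuclideanSpace ℝ (Fin d))).map (fun ξ ↦ ξ + a)) :=
    (measurableEmbedding_addRight a).integrable_map_iff.2 h.1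
  rw [map_add_stdGaussian, integrable_withDensity_iff_integrable_smul' (by fun_prop)
      (Filter.Eventually.of_forall fun _ ↦ ENNReal.ofReal_lt_top)] at h'
  simpa only [ENNReal.toReal_ofReal (gaussTilt_pos a _).le] using h'

lemma hasIntegral_gaussTilt (a : EuclideanSpace ℝ (Fin d)) :
    HasIntegral (stdGaussian (EuclideanSpace ℝ (Fin d))) (gaussTilt a) 1 :=
  (hasIntegral_gaussTilt_smul a (f := fun _ ↦ (1 : ℝ)) (hasIntegral_const 1)).congr
    (fun _ ↦ by simp) rfl

lemma hasIntegral_clm_stdGaussian {V : Type*} [NormedAddCommGroup V] [NormedSpace ℝ V]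
    [CompleteSpace V] (T : EuclideanSpace ℝ (Fin d) →L[ℝ] V) :
    HasIntegral (stdGaussian (EuclideanSpace ℝ (Fin d))) (fun ξ ↦ T ξ) 0 := by
  have hid : Integrable (fun ξ ↦ ξ) (stdGaussian (EuclideanSpace ℝ (Fin d))) :=
    IsGaussian.integrable_id
  refine ⟨T.integrable_comp hid, ?_⟩
  rw [ContinuousLinearMap.integral_comp_comm T hid, integral_id_stdGaussian, map_zero]

lemma hasIntegral_inner_stdGaussian (a : EuclideanSpace ℝ (Fin d)) :
    HasIntegral (stdGaussian (EuclideanSpace ℝ (Fin d))) (fun ξ ↦ (inner ℝ a ξ : ℝ)) 0 :=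
  hasIntegral_clm_stdGaussian (innerSL ℝ a)

lemma hasIntegral_inner_mul_inner_stdGaussian (a b : EuclideanSpace ℝ (Fin d)) :
    HasIntegral (stdGaussian (EuclideanSpace ℝ (Fin d)))
      (fun ξ ↦ (inner ℝ a ξ * inner ℝ b ξ : ℝ)) (inner ℝ a b) := by
  refine ⟨((innerSL ℝ a).comp_memLp' IsGaussian.memLp_two_id).integrable_mul
    ((innerSL ℝ b).comp_memLp' IsGaussian.memLp_two_id), ?_⟩
  have h := covarianceBilin_apply (μ := stdGaussian (EuclideanSpace ℝ (Fin d)))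
    IsGaussian.memLp_two_id a b
  rw [covarianceBilin_stdGaussian, innerSL_apply_apply] at h
  simpa using h.symm

lemma inner_diagMap_diagMap (f g : Fin d → ℝ) (x y : EuclideanSpace ℝ (Fin d)) :
    inner ℝ (diagMap f x) (diagMap g y) = ∑ j, (f j * g j) * (x j * y j) := by
  simp only [PiLp.inner_apply, RCLike.inner_apply, conj_trivial, diagMap_apply]
  exact Finset.sum_congr rfl fun j _ ↦ by ring

lemma norm_diagMap_sq (f : Fin d → ℝ) (x : EuclideanSpace ℝ (Fin d)) :
    ‖diagMap f x‖ ^ 2 = ∑ j, f j ^ 2 * x j ^ 2 := by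
  rw [EuclideanSpace.real_norm_sq_eq]
  exact Finset.sum_congr rfl fun j _ ↦ by rw [diagMap_apply]; ring

lemma hasIntegral_diagMap_inner_self (f : Fin d → ℝ) :
    HasIntegral (stdGaussian (EuclideanSpace ℝ (Fin d)))
      (fun ξ ↦ (inner ℝ (diagMap f ξ) (diagMap f ξ) : ℝ)) (∑ j, f j ^ 2) := by
  refine (hasIntegral_finsetSum Finset.univ fun j _ ↦ (hasIntegral_inner_mul_inner_stdGaussian
    (EuclideanSpace.single j (1 : ℝ)) (EuclideanSpace.single j (1 : ℝ))).const_mul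
      (f j ^ 2)).congr (fun ξ ↦ ?_) (by simp)
  rw [inner_diagMap_diagMap]
  refine Finset.sum_congr rfl fun j _ ↦ ?_
  simp only [EuclideanSpace.inner_single_left, map_one, one_mul]
  ring

lemma hasIntegral_inner_diagMap_add (f : Fin d → ℝ) (v w : EuclideanSpace ℝ (Fin d)) :
    HasIntegral (stdGaussian (EuclideanSpace ℝ (Fin d)))
      (fun ξ ↦ (inner ℝ (diagMap f ξ + v) (diagMap f ξ + w) : ℝ))
      (∑ j, f j ^ 2 + inner ℝ v w) := by
  have h0 := hasIntegral_clm_stdGaussian (diagMap f)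
  refine (((hasIntegral_diagMap_inner_self f).add (h0.const_inner w)).add
    ((h0.const_inner v).add (hasIntegral_const (inner ℝ v w)))).congr (fun ξ ↦ ?_) (by simp)
  rw [inner_add_left, inner_add_right, inner_add_right, real_inner_comm w (diagMap f ξ)]

lemma hasIntegral_gaussTilt_mul_inner (a b : EuclideanSpace ℝ (Fin d)) :
    HasIntegral (stdGaussian (EuclideanSpace ℝ (Fin d)))
      (fun ξ ↦ gaussTilt a ξ * inner ℝ b ξ) (inner ℝ a b) := by
  refine hasIntegral_gaussTilt_smul a (f := fun ξ ↦ (inner ℝ b ξ : ℝ)) ?_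
  refine ((hasIntegral_inner_stdGaussian b).add (hasIntegral_const (inner ℝ b a))).congr
    (fun ξ ↦ ?_) ?_
  · rw [inner_add_right]
  · rw [zero_add, real_inner_comm]

lemma hasIntegral_gaussTilt_mul_gaussTilt (a b : EuclideanSpace ℝ (Fin d)) :
    HasIntegral (stdGaussian (EuclideanSpace ℝ (Fin d)))
      (fun ξ ↦ gaussTilt a ξ * gaussTilt b ξ) (Real.exp (inner ℝ a b)) :=
  ((hasIntegral_gaussTilt (a + b)).const_mul (Real.exp (inner ℝ a b))).congr
    (fun ξ ↦ (gaussTilt_mul_gaussTilt a b ξ).symm) (mul_one _)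

lemma gaussRem_mul_gaussRem (a b ξ : EuclideanSpace ℝ (Fin d)) :
    gaussRem a ξ * gaussRem b ξ = (gaussTilt a ξ * gaussTilt b ξ - gaussTilt a ξ
      - gaussTilt a ξ * inner ℝ b ξ) + (1 - gaussTilt b ξ + inner ℝ b ξ) +
      (inner ℝ a ξ * inner ℝ b ξ - gaussTilt b ξ * inner ℝ a ξ + inner ℝ a ξ) := by
  unfold gaussRem; ring

/-- The remainder is the tilt without its Hermite components of degree zero and one, so the pairing
exp⟨a, b⟩ of two tilts loses the corresponding terms of its series. -/
lemma hasIntegral_gaussRem_mul_gaussRem (a b : EuclideanSpace ℝ (Fin d)) :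
    HasIntegral (stdGaussian (EuclideanSpace ℝ (Fin d)))
      (fun ξ ↦ gaussRem a ξ * gaussRem b ξ) (Real.exp (inner ℝ a b) - 1 - inner ℝ a b) := by
  refine ((((((hasIntegral_gaussTilt_mul_gaussTilt a b).sub (hasIntegral_gaussTilt a)).sub
    (hasIntegral_gaussTilt_mul_inner a b)).add (((hasIntegral_const 1).sub
    (hasIntegral_gaussTilt b)).add (hasIntegral_inner_stdGaussian b)))).add
    (((hasIntegral_inner_mul_inner_stdGaussian a b).sub
    (hasIntegral_gaussTilt_mul_inner b a)).add (hasIntegral_inner_stdGaussian a))).congr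
    (fun ξ ↦ (gaussRem_mul_gaussRem a b ξ).symm) ?_
  rw [real_inner_comm a b]
  ring

lemma integrable_gaussRem (a : EuclideanSpace ℝ (Fin d)) :
    Integrable (gaussRem a) (stdGaussian (EuclideanSpace ℝ (Fin d))) :=
  ((hasIntegral_gaussTilt a).1.sub (integrable_const 1)).sub (hasIntegral_inner_stdGaussian a).1

lemma integral_abs_gaussRem_le (a : EuclideanSpace ℝ (Fin d)) :
    ∫ ξ, |gaussRem a ξ| ∂(stdGaussian (EuclideanSpace ℝ (Fin d))) ≤ 3 * ‖a‖ ^ 2 := by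
  rcases eq_or_ne a 0 with rfl | ha
  · simp [gaussRem, gaussTilt]
  have hpos : 0 < ‖a‖ := norm_pos_iff.2 ha
  rcases le_or_gt ‖a‖ 1 with h1 | h1
  · set s := ‖a‖ ^ 2 with hs
    have hs0 : 0 < s := by positivity
    have hs1 : s ≤ 1 := by rw [hs]; nlinarith
    -- The weight balances the two terms: the second moment of the remainder is at most s², so each
    -- contributes s/2 on average.
    have hle : ∀ ξ : EuclideanSpace ℝ (Fin d),
        |gaussRem a ξ| ≤ (2 * s)⁻¹ * (gaussRem a ξ * gaussRem a ξ) + s / 2 := by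
      intro ξ
      have : (2 * s)⁻¹ * (gaussRem a ξ * gaussRem a ξ) + s / 2 - |gaussRem a ξ| =
          (2 * s)⁻¹ * (|gaussRem a ξ| - s) ^ 2 := by
        rw [← abs_mul_abs_self (gaussRem a ξ)]; field_simp; ring
      have : 0 ≤ (2 * s)⁻¹ * (|gaussRem a ξ| - s) ^ 2 := by positivity
      linarith
    have hi := ((hasIntegral_gaussRem_mul_gaussRem a a).const_mul (2 * s)⁻¹).add
      (hasIntegral_const (s / 2))
    have hm := integral_mono (integrable_gaussRem a).abs hi.1 hle
    rw [hi.2, real_inner_self_eq_norm_sq, ← hs] at hm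
    have he : Real.exp s - 1 - s ≤ s ^ 2 :=
      (le_abs_self _).trans (Real.abs_exp_sub_one_sub_id_le (by rwa [abs_of_pos hs0]))
    have : (2 * s)⁻¹ * (Real.exp s - 1 - s) ≤ (2 * s)⁻¹ * s ^ 2 := by gcongr
    have e2 : (2 * s)⁻¹ * s ^ 2 = s / 2 := by field_simp
    linarith
  -- For ‖a‖ > 1 no cancellation is needed: this bound has mean 5/2 + ‖a‖²/2, which is below 3‖a‖².
  · have hle : ∀ ξ : EuclideanSpace ℝ (Fin d), |gaussRem a ξ| ≤
        gaussTilt a ξ + 1 + (1 / 2 * (inner ℝ a ξ * inner ℝ a ξ) + 1 / 2) := by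
      intro ξ
      unfold gaussRem
      have h2 := gaussTilt_pos a ξ
      rw [abs_le]
      constructor <;> nlinarith [sq_nonneg ((inner ℝ a ξ : ℝ) - 1), sq_nonneg ((inner ℝ a ξ : ℝ) + 1)]
    have hi := ((hasIntegral_gaussTilt a).add (hasIntegral_const 1)).add
      (((hasIntegral_inner_mul_inner_stdGaussian a a).const_mul (1 / 2)).add
      (hasIntegral_const (1 / 2)))
    have hm := integral_mono (integrable_gaussRem a).abs hi.1 hle
    rw [hi.2, real_inner_self_eq_norm_sq] at hm
    nlinarith

/-- The product of tilts is merged into one, so that each tilt multiplies an inner product of affine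
functions of `ξ` and the shift formula applies term by term. -/
lemma inner_tilt_diagMap_sub (f : Fin d → ℝ) (a b ξ : EuclideanSpace ℝ (Fin d)) :
    inner ℝ (diagMap f (gaussTilt a ξ • (ξ - a) - ξ)) (diagMap f (gaussTilt b ξ • (ξ - b) - ξ)) =
      (Real.exp (inner ℝ a b) * (gaussTilt (a + b) ξ •
        inner ℝ (diagMap f ξ + diagMap f (-a)) (diagMap f ξ + diagMap f (-b))) +
      inner ℝ (diagMap f ξ + 0) (diagMap f ξ + 0)) -
      (gaussTilt a ξ • inner ℝ (diagMap f ξ + diagMap f (-a)) (diagMap f ξ + 0) +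
      gaussTilt b ξ • inner ℝ (diagMap f ξ + 0) (diagMap f ξ + diagMap f (-b))) := by
  have h := gaussTilt_mul_gaussTilt a b ξ
  rw [smul_eq_mul, ← mul_assoc, ← h]
  simp only [map_sub, map_smul, map_neg, inner_sub_left, inner_sub_right, inner_smul_left,
    inner_smul_right, inner_add_left, inner_add_right, inner_neg_left, inner_neg_right,
    smul_eq_mul, conj_trivial, add_zero]
  ring

/-- Shifting by a + b turns ξ - a and ξ - b into ξ + b and ξ + a, which gives the exponential term.
In each mixed term one factor becomes centered, leaving only the trace; two traces are subtracted
and one is added. -/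
lemma hasIntegral_inner_tilt_diagMap_sub (f : Fin d → ℝ) (a b : EuclideanSpace ℝ (Fin d)) :
    HasIntegral (stdGaussian (EuclideanSpace ℝ (Fin d)))
      (fun ξ ↦ (inner ℝ (diagMap f (gaussTilt a ξ • (ξ - a) - ξ))
        (diagMap f (gaussTilt b ξ • (ξ - b) - ξ)) : ℝ))
      (Real.exp (inner ℝ a b) * (∑ j, f j ^ 2 + inner ℝ (diagMap f a) (diagMap f b))
        - ∑ j, f j ^ 2) := by
  have key : ∀ c v w : EuclideanSpace ℝ (Fin d),
      HasIntegral (stdGaussian (EuclideanSpace ℝ (Fin d)))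
        (fun ξ ↦ gaussTilt c ξ • (inner ℝ (diagMap f ξ + v) (diagMap f ξ + w) : ℝ))
        (∑ j, f j ^ 2 + inner ℝ (diagMap f c + v) (diagMap f c + w)) := by
    intro c v w
    refine hasIntegral_gaussTilt_smul c
      (f := fun ξ ↦ (inner ℝ (diagMap f ξ + v) (diagMap f ξ + w) : ℝ)) ?_
    simp only [map_add, add_assoc]
    exact hasIntegral_inner_diagMap_add f _ _
  refine ((((key (a + b) (diagMap f (-a)) (diagMap f (-b))).const_mul
    (Real.exp (inner ℝ a b))).add (hasIntegral_inner_diagMap_add f 0 0)).sub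
    ((key a (diagMap f (-a)) 0).add (key b 0 (diagMap f (-b))))).congr
    (fun ξ ↦ (inner_tilt_diagMap_sub f a b ξ).symm) ?_
  have e1 : diagMap f (a + b) + diagMap f (-a) = diagMap f b := by rw [← map_add]; congr 1; abel
  have e2 : diagMap f (a + b) + diagMap f (-b) = diagMap f a := by rw [← map_add]; congr 1; abel
  have e3 : diagMap f a + diagMap f (-a) = 0 := by rw [← map_add]; simp
  have e4 : diagMap f b + diagMap f (-b) = 0 := by rw [← map_add]; simp
  rw [e1, e2, e3, e4, inner_zero_left, inner_zero_left, inner_zero_right,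
    real_inner_comm (diagMap f a)]
  ring

end Gauss

/-! ### Moments of centered bounded laws -/

/-- The law `ν` is centered, bounded by `β`, and has diagonal covariance with entries `σ`. -/
structure IsCenteredBounded {d : ℕ} (ν : Measure (EuclideanSpace ℝ (Fin d))) (σ : Fin d → ℝ)
    (β : ℝ) : Prop where
  bound : ∀ᵐ x ∂ν, ‖x‖ ≤ β
  mean : ∫ x, x ∂ν = 0
  cov : ∀ i j, ∫ x, x i * x j ∂ν = if i = j then σ i else 0

lemma hasIntegral_mul_prod {α : Type*} [MeasurableSpace α] {μ ν : Measure α} [SFinite μ]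
    [SFinite ν] {f g : α → ℝ} {v w : ℝ} (hf : HasIntegral μ f v) (hg : HasIntegral ν g w) :
    HasIntegral (μ.prod ν) (fun z ↦ f z.1 * g z.2) (v * w) :=
  ⟨hf.1.mul_prod hg.1, by rw [integral_prod_mul, hf.2, hg.2]⟩

namespace IsCenteredBounded

variable {d : ℕ} {ν : Measure (EuclideanSpace ℝ (Fin d))}
  {σ : Fin d → ℝ} {β : ℝ}

lemma variance_nonneg (h : IsCenteredBounded ν σ β) (i : Fin d) : 0 ≤ σ i := by
  have := h.cov i i
  rw [if_pos rfl] at this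
  rw [← this]
  exact integral_nonneg fun x ↦ mul_self_nonneg _

variable [IsProbabilityMeasure ν]

lemma integrable_of_bound (h : IsCenteredBounded ν σ β) {V : Type*} [NormedAddCommGroup V]
    {f : EuclideanSpace ℝ (Fin d) → V} (hf : AEStronglyMeasurable f ν) (C : ℝ)
    (hC : ∀ x, ‖x‖ ≤ β → ‖f x‖ ≤ C) : Integrable f ν :=
  Integrable.of_bound hf C (h.bound.mono hC)

lemma nonneg (h : IsCenteredBounded ν σ β) : 0 ≤ β := by
  obtain ⟨x, hx⟩ := h.bound.exists
  exact (norm_nonneg x).trans hx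

lemma hasIntegral_id (h : IsCenteredBounded ν σ β) : HasIntegral ν (fun x ↦ x) 0 :=
  ⟨h.integrable_of_bound (by fun_prop) β fun _ hx ↦ hx, h.mean⟩

lemma hasIntegral_clm (h : IsCenteredBounded ν σ β) {V : Type*} [NormedAddCommGroup V]
    [NormedSpace ℝ V] [CompleteSpace V] (T : EuclideanSpace ℝ (Fin d) →L[ℝ] V) :
    HasIntegral ν (fun x ↦ T x) 0 :=
  ⟨T.integrable_comp h.hasIntegral_id.1, by
    rw [ContinuousLinearMap.integral_comp_comm T h.hasIntegral_id.1, h.mean, map_zero]⟩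

lemma hasIntegral_apply_mul_apply (h : IsCenteredBounded ν σ β) (i j : Fin d) :
    HasIntegral ν (fun x ↦ x i * x j) (if i = j then σ i else 0) := by
  refine ⟨h.integrable_of_bound (by fun_prop) (β * β) fun x hx ↦ ?_, h.cov i j⟩
  rw [norm_mul]
  have hβ := h.nonneg
  gcongr
  · exact (PiLp.norm_apply_le x i).trans hx
  · exact (PiLp.norm_apply_le x j).trans hx

lemma sum_variance_le (h : IsCenteredBounded ν σ β) : ∑ i, σ i ≤ β ^ 2 := by
  have h1 := hasIntegral_finsetSum Finset.univ fun i _ ↦ h.hasIntegral_apply_mul_apply i i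
  simp only [if_true] at h1
  rw [← h1.2]
  have h2 : HasIntegral ν (fun _ ↦ β ^ 2) (β ^ 2) := hasIntegral_const _
  conv_rhs => rw [← h2.2]
  refine integral_mono_ae h1.1 h2.1 ?_
  filter_upwards [h.bound] with x hx
  have e : ∑ i, x i * x i = ‖x‖ ^ 2 := by
    rw [EuclideanSpace.real_norm_sq_eq]; exact Finset.sum_congr rfl fun i _ ↦ (pow_two _).symm
  rw [e]
  gcongr

lemma variance_le (h : IsCenteredBounded ν σ β) (i : Fin d) : σ i ≤ β ^ 2 :=
  (Finset.single_le_sum (fun j _ ↦ h.variance_nonneg j) (Finset.mem_univ i)).trans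
    h.sum_variance_le

lemma hasIntegral_bilin (h : IsCenteredBounded ν σ β) (g : Fin d → ℝ) :
    HasIntegral (ν.prod ν) (fun z ↦ ∑ j, g j * (z.1 j * z.2 j)) 0 := by
  have h0 : ∀ j, HasIntegral ν (fun x ↦ x j) 0 := fun j ↦
    h.hasIntegral_clm (EuclideanSpace.proj j)
  refine (hasIntegral_finsetSum Finset.univ fun j _ ↦
    (hasIntegral_mul_prod (h0 j) (h0 j)).const_mul (g j)).congr (fun _ ↦ rfl) (by simp)

/-- Independence of the two copies squares each covariance entry, and a diagonal covariance leaves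
only the diagonal terms. -/
lemma hasIntegral_bilin_sq (h : IsCenteredBounded ν σ β) (g : Fin d → ℝ) :
    HasIntegral (ν.prod ν) (fun z ↦ (∑ j, g j * (z.1 j * z.2 j)) ^ 2)
      (∑ j, g j ^ 2 * σ j ^ 2) := by
  refine (hasIntegral_finsetSum Finset.univ fun i _ ↦ hasIntegral_finsetSum Finset.univ fun j _ ↦
    (hasIntegral_mul_prod (h.hasIntegral_apply_mul_apply i j)
      (h.hasIntegral_apply_mul_apply i j)).const_mul (g i * g j)).congr (fun z ↦ ?_) ?_
  · rw [pow_two, Finset.sum_mul_sum]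
    exact Finset.sum_congr rfl fun i _ ↦ Finset.sum_congr rfl fun j _ ↦ by ring
  · refine Finset.sum_congr rfl fun i _ ↦ ?_
    simp only [mul_ite, mul_zero, ite_mul, zero_mul]
    rw [Finset.sum_ite_eq]
    simp
    ring

end IsCenteredBounded

/-! ### The conditional mean velocity and its second moment -/

/-- Second moment of a `ν`-average of vector fields, through two independent copies. -/
lemma hasIntegral_norm_integral_sq {d : ℕ} {ν : Measure (EuclideanSpace ℝ (Fin d))}
    [IsProbabilityMeasure ν] {σ : Fin d → ℝ} {β : ℝ} (h : IsCenteredBounded ν σ β)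
    {F : EuclideanSpace ℝ (Fin d) → EuclideanSpace ℝ (Fin d) → EuclideanSpace ℝ (Fin d)}
    (hF : Measurable (Function.uncurry F)) (C b : ℝ)
    (hb : ∀ ξ x, ‖x‖ ≤ β → ‖F ξ x‖ ≤ C * Real.exp (b * ‖ξ‖)) :
    HasIntegral (stdGaussian (EuclideanSpace ℝ (Fin d))) (fun ξ ↦ ‖∫ x, F ξ x ∂ν‖ ^ 2)
      (∫ z, ∫ ξ, inner ℝ (F ξ z.1) (F ξ z.2) ∂(stdGaussian (EuclideanSpace ℝ (Fin d)))
        ∂(ν.prod ν)) := by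
  have hFm : ∀ ξ, Measurable (F ξ) := fun ξ ↦ hF.of_uncurry_left
  have hFi : ∀ ξ, Integrable (F ξ) ν := fun ξ ↦
    h.integrable_of_bound (hFm ξ).aestronglyMeasurable _ (hb ξ)
  have hsq : ∀ ξ, ‖∫ x, F ξ x ∂ν‖ ^ 2 = ∫ z, inner ℝ (F ξ z.1) (F ξ z.2) ∂(ν.prod ν) := by
    intro ξ
    have hi : Integrable (fun z : EuclideanSpace ℝ (Fin d) × EuclideanSpace ℝ (Fin d) ↦
        (inner ℝ (F ξ z.1) (F ξ z.2) : ℝ)) (ν.prod ν) := by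
      refine ((hFi ξ).norm.mul_prod (hFi ξ).norm).mono' ?_ ?_
      · have := hFm ξ
        exact Measurable.aestronglyMeasurable (by fun_prop)
      · exact Filter.Eventually.of_forall fun z ↦ abs_real_inner_le_norm _ _
    rw [integral_prod _ hi, ← real_inner_self_eq_norm_sq, ← integral_inner (hFi ξ)]
    refine integral_congr_ae (Filter.Eventually.of_forall fun x ↦ ?_)
    simp only
    rw [integral_inner (hFi ξ), real_inner_comm]
  have hint : Integrable (Function.uncurry fun (ξ : EuclideanSpace ℝ (Fin d))
      (z : EuclideanSpace ℝ (Fin d) × EuclideanSpace ℝ (Fin d)) ↦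
        (inner ℝ (F ξ z.1) (F ξ z.2) : ℝ))
      ((stdGaussian (EuclideanSpace ℝ (Fin d))).prod (ν.prod ν)) := by
    have hdom := ((integrable_exp_mul_norm (d := d) (2 * b)).const_mul (C ^ 2)).comp_fst (ν.prod ν)
    refine hdom.mono' ?_ ?_
    · have m1 : Measurable fun w : EuclideanSpace ℝ (Fin d) ×
          (EuclideanSpace ℝ (Fin d) × EuclideanSpace ℝ (Fin d)) ↦ F w.1 w.2.1 :=
        hF.comp (by fun_prop : Measurable fun w : EuclideanSpace ℝ (Fin d) ×
          (EuclideanSpace ℝ (Fin d) × EuclideanSpace ℝ (Fin d)) ↦ (w.1, w.2.1))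
      have m2 : Measurable fun w : EuclideanSpace ℝ (Fin d) ×
          (EuclideanSpace ℝ (Fin d) × EuclideanSpace ℝ (Fin d)) ↦ F w.1 w.2.2 :=
        hF.comp (by fun_prop : Measurable fun w : EuclideanSpace ℝ (Fin d) ×
          (EuclideanSpace ℝ (Fin d) × EuclideanSpace ℝ (Fin d)) ↦ (w.1, w.2.2))
      exact (m1.inner m2).aestronglyMeasurable
    · have b1 : ∀ᵐ w ∂((stdGaussian (EuclideanSpace ℝ (Fin d))).prod (ν.prod ν)),
          ‖w.2.1‖ ≤ β := (Measure.quasiMeasurePreserving_fst.comp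
            Measure.quasiMeasurePreserving_snd).ae h.bound
      have b2 : ∀ᵐ w ∂((stdGaussian (EuclideanSpace ℝ (Fin d))).prod (ν.prod ν)),
          ‖w.2.2‖ ≤ β := (Measure.quasiMeasurePreserving_snd.comp
            Measure.quasiMeasurePreserving_snd).ae h.bound
      filter_upwards [b1, b2] with w h1 h2
      have e : Real.exp (2 * b * ‖w.1‖) = Real.exp (b * ‖w.1‖) * Real.exp (b * ‖w.1‖) := by
        rw [← Real.exp_add]; congr 1; ring
      calc ‖(inner ℝ (F w.1 w.2.1) (F w.1 w.2.2) : ℝ)‖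
          ≤ ‖F w.1 w.2.1‖ * ‖F w.1 w.2.2‖ := abs_real_inner_le_norm _ _
        _ ≤ (C * Real.exp (b * ‖w.1‖)) * (C * Real.exp (b * ‖w.1‖)) :=
          mul_le_mul (hb _ _ h1) (hb _ _ h2) (norm_nonneg _)
            ((norm_nonneg _).trans (hb _ _ h1))
        _ = _ := by rw [e]; ring
  simp_rw [hsq]
  exact ⟨hint.integral_prod_left, integral_integral_swap hint⟩

/-- The Cameron–Martin formula applied conditionally on the second coordinate, which fixes the
shift. -/
lemma map_prod_add_stdGaussian {d : ℕ} (ν : Measure (EuclideanSpace ℝ (Fin d)))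
    [IsProbabilityMeasure ν] {a : EuclideanSpace ℝ (Fin d) → EuclideanSpace ℝ (Fin d)}
    (ha : Measurable a) :
    ((stdGaussian (EuclideanSpace ℝ (Fin d))).prod ν).map (fun z ↦ (z.1 + a z.2, z.2)) =
      ((stdGaussian (EuclideanSpace ℝ (Fin d))).prod ν).withDensity
        (fun z ↦ ENNReal.ofReal (gaussTilt (a z.2) z.1)) := by
  refine Measure.ext_of_lintegral _ fun f hf ↦ ?_
  have hT : Measurable fun z : EuclideanSpace ℝ (Fin d) × EuclideanSpace ℝ (Fin d) ↦
      (z.1 + a z.2, z.2) := by fun_prop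
  have hD : Measurable fun z : EuclideanSpace ℝ (Fin d) × EuclideanSpace ℝ (Fin d) ↦
      ENNReal.ofReal (gaussTilt (a z.2) z.1) := by fun_prop
  rw [lintegral_map hf hT, lintegral_withDensity_eq_lintegral_mul _ hD hf,
    lintegral_prod_symm (fun z ↦ f (z.1 + a z.2, z.2)) (hf.comp hT).aemeasurable,
    lintegral_prod_symm _ (hD.mul hf).aemeasurable]
  refine lintegral_congr fun x ↦ ?_
  exact lintegral_add_stdGaussian (a x) (f := fun ξ ↦ f (ξ, x)) (by fun_prop)

lemma ae_prod_norm_le {d : ℕ} {ν : Measure (EuclideanSpace ℝ (Fin d))} {σ : Fin d → ℝ}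
    {β : ℝ} (h : IsCenteredBounded ν σ β) :
    ∀ᵐ z ∂(ν.prod ν), ‖z.1‖ ≤ β ∧ ‖z.2‖ ≤ β :=
  (Measure.quasiMeasurePreserving_fst.ae h.bound).and
    (Measure.quasiMeasurePreserving_snd.ae h.bound)

lemma sum_sq_mul_sq_le {d : ℕ} {ν : Measure (EuclideanSpace ℝ (Fin d))}
    {σ s : Fin d → ℝ} {β q : ℝ} (h : IsCenteredBounded ν σ β) (hsσ : ∀ j, s j ^ 2 * σ j ≤ q) :
    ∑ j, (s j * s j) ^ 2 * σ j ^ 2 ≤ d * q ^ 2 := by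
  calc ∑ j, (s j * s j) ^ 2 * σ j ^ 2 ≤ ∑ _j : Fin d, q ^ 2 := by
        refine Finset.sum_le_sum fun j _ ↦ ?_
        have h0 : 0 ≤ s j ^ 2 * σ j := mul_nonneg (sq_nonneg _) (h.variance_nonneg j)
        calc _ = (s j ^ 2 * σ j) ^ 2 := by ring
          _ ≤ q ^ 2 := by gcongr; exact hsσ j
    _ = d * q ^ 2 := by simp

section Velocity

variable {d : ℕ} {ν : Measure (EuclideanSpace ℝ (Fin d))} [IsProbabilityMeasure ν]
  {σ s : Fin d → ℝ} {β q : ℝ}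

lemma norm_diagMap_sq_le_half (hsβ : ∀ j, s j ^ 2 * (2 * β ^ 2) ≤ 1)
    {x : EuclideanSpace ℝ (Fin d)} (hx : ‖x‖ ≤ β) : ‖diagMap s x‖ ^ 2 ≤ 1 / 2 := by
  rcases (norm_nonneg x).trans hx |>.eq_or_lt with h0 | hpos
  · have : x = 0 := norm_le_zero_iff.1 (hx.trans h0.symm.le)
    simp [this]
  rw [norm_diagMap_sq]
  calc ∑ j, s j ^ 2 * x j ^ 2 ≤ ∑ j, (2 * β ^ 2)⁻¹ * x j ^ 2 := by
        refine Finset.sum_le_sum fun j _ ↦ ?_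
        gcongr
        rw [← one_div, le_div_iff₀ (by positivity)]
        exact hsβ j
    _ = (2 * β ^ 2)⁻¹ * ‖x‖ ^ 2 := by rw [EuclideanSpace.real_norm_sq_eq, Finset.mul_sum]
    _ ≤ (2 * β ^ 2)⁻¹ * β ^ 2 := by gcongr
    _ = 1 / 2 := by field_simp

lemma norm_diagMap_le_one (hsβ : ∀ j, s j ^ 2 * (2 * β ^ 2) ≤ 1)
    {x : EuclideanSpace ℝ (Fin d)} (hx : ‖x‖ ≤ β) : ‖diagMap s x‖ ≤ 1 := by
  have := norm_diagMap_sq_le_half hsβ hx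
  nlinarith [norm_nonneg (diagMap s x)]

lemma abs_inner_diagMap_le_one (hsβ : ∀ j, s j ^ 2 * (2 * β ^ 2) ≤ 1)
    {x y : EuclideanSpace ℝ (Fin d)} (hx : ‖x‖ ≤ β) (hy : ‖y‖ ≤ β) :
    |(inner ℝ (diagMap s x) (diagMap s y) : ℝ)| ≤ 1 :=
  (abs_real_inner_le_norm _ _).trans (mul_le_one₀ (norm_diagMap_le_one hsβ hx) (norm_nonneg _)
    (norm_diagMap_le_one hsβ hy))

lemma gaussTilt_le_exp_norm {a : EuclideanSpace ℝ (Fin d)} (ha : ‖a‖ ≤ 1)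
    (ξ : EuclideanSpace ℝ (Fin d)) : gaussTilt a ξ ≤ Real.exp ‖ξ‖ :=
  (gaussTilt_le a ξ).trans (Real.exp_le_exp.2 (by nlinarith [norm_nonneg ξ]))

lemma abs_gaussRem_le_exp_norm {a : EuclideanSpace ℝ (Fin d)} (ha : ‖a‖ ≤ 1)
    (ξ : EuclideanSpace ℝ (Fin d)) : |gaussRem a ξ| ≤ 3 * Real.exp ‖ξ‖ := by
  have h1 := gaussTilt_le_exp_norm ha ξ
  have h2 := gaussTilt_pos a ξ
  have h3 : |(inner ℝ a ξ : ℝ)| ≤ ‖ξ‖ :=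
    (abs_real_inner_le_norm a ξ).trans (by nlinarith [norm_nonneg ξ])
  have h4 := Real.add_one_le_exp ‖ξ‖
  have h5 := norm_nonneg ξ
  rw [abs_le] at h3
  unfold gaussRem
  rw [abs_le]
  constructor <;> linarith

lemma norm_gaussTilt_smul_sub_le {a : EuclideanSpace ℝ (Fin d)} (ha : ‖a‖ ≤ 1)
    (ξ : EuclideanSpace ℝ (Fin d)) :
    ‖gaussTilt a ξ • (ξ - a)‖ ≤ Real.exp (2 * ‖ξ‖) := by
  have h1 := gaussTilt_le_exp_norm ha ξ
  have h4 := Real.add_one_le_exp ‖ξ‖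
  have e : Real.exp (2 * ‖ξ‖) = Real.exp ‖ξ‖ * Real.exp ‖ξ‖ := by
    rw [← Real.exp_add]; congr 1; ring
  rw [norm_smul, Real.norm_of_nonneg (gaussTilt_pos a ξ).le, e]
  gcongr
  calc ‖ξ - a‖ ≤ ‖ξ‖ + ‖a‖ := norm_sub_le _ _
    _ ≤ _ := by linarith

lemma integral_le_of_abs_le {α : Type*} [MeasurableSpace α] {μ : Measure α} {f g : α → ℝ}
    {v : ℝ} (hg : HasIntegral μ g v) (h : ∀ᵐ x ∂μ, |f x| ≤ g x) : ∫ x, f x ∂μ ≤ v :=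
  (Real.le_norm_self _).trans ((norm_integral_le_of_norm_le hg.1 h).trans hg.2.le)

/-- Second moment of the average of the remainder times the bounded vector. -/
lemma exists_hasIntegral_norm_integral_gaussRem_sq (h : IsCenteredBounded ν σ β)
    (hsβ : ∀ j, s j ^ 2 * (2 * β ^ 2) ≤ 1) (hsσ : ∀ j, s j ^ 2 * σ j ≤ q) :
    ∃ v ≤ β ^ 2 * (d * q ^ 2), HasIntegral (stdGaussian (EuclideanSpace ℝ (Fin d)))
      (fun ξ ↦ ‖∫ x, gaussRem (diagMap s x) ξ • x ∂ν‖ ^ 2) v := by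
  have hβ := h.nonneg
  refine ⟨_, ?_, hasIntegral_norm_integral_sq h (F := fun ξ x ↦ gaussRem (diagMap s x) ξ • x)
    (by unfold Function.uncurry; fun_prop) (3 * β) 1 fun ξ x hx ↦ ?_⟩
  · have e : ∀ z : EuclideanSpace ℝ (Fin d) × EuclideanSpace ℝ (Fin d),
        ∫ ξ, (inner ℝ (gaussRem (diagMap s z.1) ξ • z.1) (gaussRem (diagMap s z.2) ξ • z.2) : ℝ)
          ∂(stdGaussian (EuclideanSpace ℝ (Fin d))) =
        inner ℝ z.1 z.2 * (Real.exp (inner ℝ (diagMap s z.1) (diagMap s z.2)) - 1 -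
          inner ℝ (diagMap s z.1) (diagMap s z.2)) := by
      intro z
      refine ((hasIntegral_gaussRem_mul_gaussRem (diagMap s z.1) (diagMap s z.2)).const_mul
        (inner ℝ z.1 z.2) |>.congr (fun ξ ↦ ?_) rfl).2
      rw [real_inner_smul_left, real_inner_smul_right]
      ring
    simp_rw [e]
    -- With p the inner product of the scaled copies and |p| ≤ 1, the exponential remainder is at
    -- most p², while |⟨x, y⟩| ≤ β²; averaging p² over the copies gives at most d q².
    refine (integral_le_of_abs_le
      ((h.hasIntegral_bilin_sq (fun j ↦ s j * s j)).const_mul (β ^ 2)) ?_).trans ?_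
    · filter_upwards [ae_prod_norm_le h] with z hz
      rw [← inner_diagMap_diagMap, abs_mul]
      refine mul_le_mul ?_ (Real.abs_exp_sub_one_sub_id_le
        (abs_inner_diagMap_le_one hsβ hz.1 hz.2)) (abs_nonneg _) (sq_nonneg _)
      calc _ ≤ ‖z.1‖ * ‖z.2‖ := abs_real_inner_le_norm _ _
        _ ≤ β * β := mul_le_mul hz.1 hz.2 (norm_nonneg _) hβ
        _ = β ^ 2 := by ring
    · gcongr
      exact sum_sq_mul_sq_le h hsσ
  · rw [norm_smul, Real.norm_eq_abs, one_mul]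
    calc _ ≤ (3 * Real.exp ‖ξ‖) * β :=
          mul_le_mul (abs_gaussRem_le_exp_norm (norm_diagMap_le_one hsβ hx) ξ) hx
            (norm_nonneg _) (by positivity)
      _ = _ := by ring

/-- Second moment of the average of the tilted Gaussian drift. -/
lemma exists_hasIntegral_norm_integral_tilt_sq (h : IsCenteredBounded ν σ β) (hβ : 0 < β)
    (hsβ : ∀ j, s j ^ 2 * (2 * β ^ 2) ≤ 1) (hsσ : ∀ j, s j ^ 2 * σ j ≤ q) (hq : q ≤ 1 / 2) :
    ∃ v ≤ 3 / 2 * β ^ 2 * (d * q ^ 2), HasIntegral (stdGaussian (EuclideanSpace ℝ (Fin d)))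
      (fun ξ ↦ ‖∫ x, diagMap (fun j ↦ s j * σ j)
        (gaussTilt (diagMap s x) ξ • (ξ - diagMap s x) - ξ) ∂ν‖ ^ 2) v := by
  set m : Fin d → ℝ := fun j ↦ s j * σ j with hm
  have hsσ0 : ∀ j, 0 ≤ s j ^ 2 * σ j := fun j ↦ mul_nonneg (sq_nonneg _) (h.variance_nonneg j)
  refine ⟨_, ?_, hasIntegral_norm_integral_sq h (F := fun ξ x ↦ diagMap m
    (gaussTilt (diagMap s x) ξ • (ξ - diagMap s x) - ξ))
    (by unfold Function.uncurry; fun_prop) (‖diagMap m‖ * 2) 2 fun ξ x hx ↦ ?_⟩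
  · set τ : ℝ := ∑ j, m j ^ 2 with hτ
    have hτ0 : 0 ≤ τ := Finset.sum_nonneg fun j _ ↦ sq_nonneg _
    have hτβ : τ ≤ β ^ 2 / 2 := by
      calc τ ≤ ∑ j, 1 / 2 * σ j := by
            refine Finset.sum_le_sum fun j _ ↦ ?_
            have h1 := hsσ j
            have h2 := h.variance_nonneg j
            calc m j ^ 2 = s j ^ 2 * σ j * σ j := by rw [hm]; ring
              _ ≤ 1 / 2 * σ j := by gcongr; linarith
        _ ≤ _ := by
            rw [← Finset.mul_sum]
            have := h.sum_variance_le
            linarith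
    simp_rw [fun z : EuclideanSpace ℝ (Fin d) × EuclideanSpace ℝ (Fin d) ↦
      (hasIntegral_inner_tilt_diagMap_sub m (diagMap s z.1) (diagMap s z.2)).2]
    set p : EuclideanSpace ℝ (Fin d) × EuclideanSpace ℝ (Fin d) → ℝ :=
      fun z ↦ inner ℝ (diagMap s z.1) (diagMap s z.2) with hp
    set r : EuclideanSpace ℝ (Fin d) × EuclideanSpace ℝ (Fin d) → ℝ :=
      fun z ↦ inner ℝ (diagMap m (diagMap s z.1)) (diagMap m (diagMap s z.2)) with hr
    have ep : ∀ z, p z = ∑ j, (s j * s j) * (z.1 j * z.2 j) := fun z ↦ inner_diagMap_diagMap _ _ _ _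
    have er : ∀ z, r z = ∑ j, (m j * s j) ^ 2 * (z.1 j * z.2 j) := by
      intro z
      simp only [hr]
      rw [inner_diagMap_diagMap]
      refine Finset.sum_congr rfl fun j _ ↦ ?_
      simp only [diagMap_apply]
      ring
    have p1 : HasIntegral (ν.prod ν) p 0 :=
      (h.hasIntegral_bilin (fun j ↦ s j * s j)).congr (fun z ↦ (ep z).symm) rfl
    have r1 : HasIntegral (ν.prod ν) r 0 :=
      (h.hasIntegral_bilin (fun j ↦ (m j * s j) ^ 2)).congr (fun z ↦ (er z).symm) rfl
    have p2 := (h.hasIntegral_bilin_sq (fun j ↦ s j * s j)).congr (g := fun z ↦ p z ^ 2)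
      (fun z ↦ by rw [ep]) rfl
    have r2 := (h.hasIntegral_bilin_sq (fun j ↦ (m j * s j) ^ 2)).congr (g := fun z ↦ r z ^ 2)
      (fun z ↦ by rw [er]) rfl
    have hsum2 : ∑ j, ((m j * s j) ^ 2) ^ 2 * σ j ^ 2 ≤ β ^ 4 / 4 * (d * q ^ 2) := by
      calc ∑ j, ((m j * s j) ^ 2) ^ 2 * σ j ^ 2 ≤ ∑ _j : Fin d, β ^ 4 / 4 * q ^ 2 := by
            refine Finset.sum_le_sum fun j _ ↦ ?_
            have h1 := hsσ j
            have h2 := h.variance_nonneg j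
            have h3 := h.variance_le j
            calc ((m j * s j) ^ 2) ^ 2 * σ j ^ 2 =
                ((s j ^ 2 * σ j) * σ j) ^ 2 * (s j ^ 2 * σ j) ^ 2 := by rw [hm]; ring
              _ ≤ (1 / 2 * β ^ 2) ^ 2 * q ^ 2 := by
                have := hsσ0 j
                gcongr
                linarith
              _ = _ := by ring
        _ = _ := by simp; ring
    -- This is the integrand minus `p * τ + r`, which has mean zero under `ν.prod ν`. What remains
    -- is of second order in the pair `p`, `r`.
    set g : EuclideanSpace ℝ (Fin d) × EuclideanSpace ℝ (Fin d) → ℝ := fun z ↦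
      (Real.exp (p z) - 1 - p z) * τ + (Real.exp (p z) - 1) * r z with hg
    have hdom := (p2.const_mul (β ^ 2)).add (r2.const_mul (2 / β ^ 2))
    have hgle : ∀ᵐ z ∂(ν.prod ν), |g z| ≤ β ^ 2 * p z ^ 2 + 2 / β ^ 2 * r z ^ 2 := by
      filter_upwards [ae_prod_norm_le h] with z hz
      have hp1 : |p z| ≤ 1 := abs_inner_diagMap_le_one hsβ hz.1 hz.2
      have b1 := Real.abs_exp_sub_one_sub_id_le hp1
      have b2 := Real.abs_exp_sub_one_le hp1
      -- The weight leaves β²/2 in front of p², matching the bound on `τ`; the two add up to β².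
      have b3 : 2 * |p z| * |r z| ≤ β ^ 2 / 2 * p z ^ 2 + 2 / β ^ 2 * r z ^ 2 := by
        have : β ^ 2 / 2 * p z ^ 2 + 2 / β ^ 2 * r z ^ 2 - 2 * |p z| * |r z| =
            1 / (2 * β ^ 2) * (β ^ 2 * |p z| - 2 * |r z|) ^ 2 := by
          rw [← sq_abs (p z), ← sq_abs (r z)]
          field_simp
          ring
        have h0 : 0 ≤ 1 / (2 * β ^ 2) * (β ^ 2 * |p z| - 2 * |r z|) ^ 2 := by positivity
        linarith
      calc |g z| ≤ |(Real.exp (p z) - 1 - p z) * τ| + |(Real.exp (p z) - 1) * r z| :=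
            abs_add_le _ _
        _ ≤ p z ^ 2 * (β ^ 2 / 2) + 2 * |p z| * |r z| := by
            rw [abs_mul, abs_mul, abs_of_nonneg hτ0]
            gcongr
        _ ≤ _ := by linarith
    have hgi : Integrable g (ν.prod ν) := hdom.1.mono'
      (Measurable.aestronglyMeasurable (by rw [hg, hp, hr]; fun_prop)) hgle
    have hfin : HasIntegral (ν.prod ν)
        (fun z ↦ Real.exp (p z) * (τ + r z) - τ) (∫ z, g z ∂(ν.prod ν)) :=
      ((show HasIntegral (ν.prod ν) g _ from ⟨hgi, rfl⟩).add ((p1.const_mul τ).add r1)).congr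
        (fun z ↦ by simp only [hg]; ring) (by simp)
    rw [hfin.2]
    refine (integral_le_of_abs_le hdom hgle).trans ?_
    calc _ ≤ β ^ 2 * (d * q ^ 2) + 2 / β ^ 2 * (β ^ 4 / 4 * (d * q ^ 2)) := by
          gcongr
          exact sum_sq_mul_sq_le h hsσ
      _ = _ := by field_simp; ring
  · refine ((diagMap m).le_opNorm _).trans ?_
    rw [mul_assoc]
    gcongr
    have h1 := norm_gaussTilt_smul_sub_le (norm_diagMap_le_one hsβ hx) ξ
    have h2 := Real.add_one_le_exp (2 * ‖ξ‖)
    calc _ ≤ ‖gaussTilt (diagMap s x) ξ • (ξ - diagMap s x)‖ + ‖ξ‖ := norm_sub_le _ _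
      _ ≤ _ := by linarith [norm_nonneg ξ]

/-- The unnormalised conditional mean of the velocity. -/
noncomputable def velocityNumerator (ν : Measure (EuclideanSpace ℝ (Fin d))) (σ s : Fin d → ℝ)
    (ξ : EuclideanSpace ℝ (Fin d)) : EuclideanSpace ℝ (Fin d) :=
  ∫ x, gaussTilt (diagMap s x) ξ • (diagMap (fun j ↦ s j * σ j) (ξ - diagMap s x) - x) ∂ν

/-- Expand the tilt of x to first order. The constant term averages to zero because `ν` is centered,
and the linear term averages to `diagMap m ξ` with m = sσ, cancelling the same term from the
Gaussian drift. This is where equality of covariances enters. -/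
lemma velocityNumerator_eq (h : IsCenteredBounded ν σ β)
    (hsβ : ∀ j, s j ^ 2 * (2 * β ^ 2) ≤ 1) (ξ : EuclideanSpace ℝ (Fin d)) :
    velocityNumerator ν σ s ξ = ∫ x, diagMap (fun j ↦ s j * σ j)
        (gaussTilt (diagMap s x) ξ • (ξ - diagMap s x) - ξ) ∂ν -
      ∫ x, gaussRem (diagMap s x) ξ • x ∂ν := by
  set m : Fin d → ℝ := fun j ↦ s j * σ j with hm
  have hβ := h.nonneg
  have i1 : Integrable (fun x ↦ diagMap m (gaussTilt (diagMap s x) ξ • (ξ - diagMap s x) - ξ)) ν := by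
    refine h.integrable_of_bound (by fun_prop) (‖diagMap m‖ * (Real.exp (2 * ‖ξ‖) + ‖ξ‖))
      fun x hx ↦ ?_
    refine ((diagMap m).le_opNorm _).trans ?_
    gcongr
    exact (norm_sub_le _ _).trans
      (by gcongr; exact norm_gaussTilt_smul_sub_le (norm_diagMap_le_one hsβ hx) ξ)
  have i2 : Integrable (fun x ↦ gaussRem (diagMap s x) ξ • x) ν := by
    refine h.integrable_of_bound (by fun_prop) (3 * Real.exp ‖ξ‖ * β) fun x hx ↦ ?_
    rw [norm_smul]
    gcongr
    exact abs_gaussRem_le_exp_norm (norm_diagMap_le_one hsβ hx) ξ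
  have i3 : HasIntegral ν (fun x ↦ (inner ℝ (diagMap s x) ξ : ℝ) • x) (diagMap m ξ) := by
    have hint : Integrable (fun x ↦ (inner ℝ (diagMap s x) ξ : ℝ) • x) ν := by
      refine h.integrable_of_bound (by fun_prop) (‖ξ‖ * β) fun x hx ↦ ?_
      rw [norm_smul]
      gcongr
      calc _ ≤ ‖diagMap s x‖ * ‖ξ‖ := abs_real_inner_le_norm _ _
        _ ≤ 1 * ‖ξ‖ := by gcongr; exact norm_diagMap_le_one hsβ hx
        _ = ‖ξ‖ := one_mul _
    refine ⟨hint, ?_⟩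
    ext j
    have e1 : (∫ x, (inner ℝ (diagMap s x) ξ : ℝ) • x ∂ν) j =
        ∫ x, ((inner ℝ (diagMap s x) ξ : ℝ) • x) j ∂ν :=
      (ContinuousLinearMap.integral_comp_comm (EuclideanSpace.proj (𝕜 := ℝ) j) hint).symm
    rw [e1]
    refine ((hasIntegral_finsetSum Finset.univ fun i _ ↦
      (h.hasIntegral_apply_mul_apply i j).const_mul (s i * ξ i)).congr (fun x ↦ ?_) ?_).2
    · simp only [PiLp.smul_apply, smul_eq_mul, PiLp.inner_apply, RCLike.inner_apply, conj_trivial,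
        diagMap_apply, Finset.sum_mul]
      exact Finset.sum_congr rfl fun i _ ↦ by ring
    · simp only [mul_ite, mul_zero, Finset.sum_ite_eq', Finset.mem_univ, if_true, diagMap_apply, hm]
      ring
  have key := ((show HasIntegral ν _ _ from ⟨i1, rfl⟩).sub
    (show HasIntegral ν _ _ from ⟨i2, rfl⟩)).add
      (((hasIntegral_const (diagMap m ξ)).sub h.hasIntegral_id).sub i3)
  have key2 := key.congr (g := fun x ↦ gaussTilt (diagMap s x) ξ •
    (diagMap m (ξ - diagMap s x) - x)) (fun x ↦ by
      simp only [gaussRem, map_sub, map_smul, smul_sub, sub_smul, one_smul]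
      abel) rfl
  rw [velocityNumerator, key2.2]
  simp

lemma measurable_velocityNumerator (ν : Measure (EuclideanSpace ℝ (Fin d)))
    [IsProbabilityMeasure ν] (σ s : Fin d → ℝ) : Measurable (velocityNumerator ν σ s) := by
  have hm : StronglyMeasurable (Function.uncurry fun (ξ x : EuclideanSpace ℝ (Fin d)) ↦
      gaussTilt (diagMap s x) ξ • (diagMap (fun j ↦ s j * σ j) (ξ - diagMap s x) - x)) :=
    Measurable.stronglyMeasurable (by unfold Function.uncurry; fun_prop)
  exact hm.integral_prod_right.measurable

/-- The constant is 5 = 2(3/2 + 1), from ‖v - w‖² ≤ 2‖v‖² + 2‖w‖² and the two preceding moment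
bounds. -/
lemma lintegral_enorm_velocityNumerator_sq_le (h : IsCenteredBounded ν σ β) (hβ : 0 < β)
    (hsβ : ∀ j, s j ^ 2 * (2 * β ^ 2) ≤ 1) (hsσ : ∀ j, s j ^ 2 * σ j ≤ q) (hq : q ≤ 1 / 2) :
    ∫⁻ ξ, ENNReal.ofReal (‖velocityNumerator ν σ s ξ‖ ^ 2)
      ∂(stdGaussian (EuclideanSpace ℝ (Fin d))) ≤ ENNReal.ofReal (5 * β ^ 2 * (d * q ^ 2)) := by
  obtain ⟨v₁, hv₁, h₁⟩ := exists_hasIntegral_norm_integral_gaussRem_sq h hsβ hsσ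
  obtain ⟨v₂, hv₂, h₂⟩ := exists_hasIntegral_norm_integral_tilt_sq h hβ hsβ hsσ hq
  have hs := (h₂.const_mul 2).add (h₁.const_mul 2)
  refine (lintegral_mono fun ξ ↦ ENNReal.ofReal_le_ofReal (?_ : _ ≤ 2 * ‖∫ x, diagMap
    (fun j ↦ s j * σ j) (gaussTilt (diagMap s x) ξ • (ξ - diagMap s x) - ξ) ∂ν‖ ^ 2 +
      2 * ‖∫ x, gaussRem (diagMap s x) ξ • x ∂ν‖ ^ 2)).trans ?_
  · rw [velocityNumerator_eq h hsβ]
    have := norm_sub_le (∫ x, diagMap (fun j ↦ s j * σ j)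
        (gaussTilt (diagMap s x) ξ • (ξ - diagMap s x) - ξ) ∂ν)
      (∫ x, gaussRem (diagMap s x) ξ • x ∂ν)
    refine (pow_le_pow_left₀ (norm_nonneg _) this 2).trans ?_
    nlinarith [sq_nonneg (‖∫ x, diagMap (fun j ↦ s j * σ j)
        (gaussTilt (diagMap s x) ξ • (ξ - diagMap s x) - ξ) ∂ν‖ -
      ‖∫ x, gaussRem (diagMap s x) ξ • x ∂ν‖)]
  · rw [← ofReal_integral_eq_lintegral_ofReal hs.1
      (Filter.Eventually.of_forall fun ξ ↦ by positivity), hs.2]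
    exact ENNReal.ofReal_le_ofReal (by linarith)

/-- The relative density of the mixture of shifted Gaussians. -/
noncomputable def mixtureDensity (ν : Measure (EuclideanSpace ℝ (Fin d))) (s : Fin d → ℝ)
    (ξ : EuclideanSpace ℝ (Fin d)) : ℝ :=
  ∫ x, gaussTilt (diagMap s x) ξ ∂ν

lemma measurable_mixtureDensity (ν : Measure (EuclideanSpace ℝ (Fin d)))
    [IsProbabilityMeasure ν] (s : Fin d → ℝ) : Measurable (mixtureDensity ν s) := by
  have hm : StronglyMeasurable (Function.uncurry fun (ξ x : EuclideanSpace ℝ (Fin d)) ↦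
      gaussTilt (diagMap s x) ξ) :=
    Measurable.stronglyMeasurable (by unfold Function.uncurry; fun_prop)
  exact hm.integral_prod_right.measurable

lemma integrable_gaussTilt_diagMap (h : IsCenteredBounded ν σ β)
    (hsβ : ∀ j, s j ^ 2 * (2 * β ^ 2) ≤ 1) (ξ : EuclideanSpace ℝ (Fin d)) :
    Integrable (fun x ↦ gaussTilt (diagMap s x) ξ) ν := by
  refine h.integrable_of_bound (Measurable.aestronglyMeasurable (by fun_prop))
    (Real.exp ‖ξ‖) fun x hx ↦ ?_
  rw [Real.norm_of_nonneg (gaussTilt_pos _ _).le]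
  exact gaussTilt_le_exp_norm (norm_diagMap_le_one hsβ hx) ξ

/-- Since ‖sx‖² ≤ 1/2, the tilt is at least exp(-1/4)(1 + ⟨sx, ξ⟩), and the linear term averages to
zero. -/
lemma exp_neg_quarter_le_mixtureDensity (h : IsCenteredBounded ν σ β)
    (hsβ : ∀ j, s j ^ 2 * (2 * β ^ 2) ≤ 1) (ξ : EuclideanSpace ℝ (Fin d)) :
    Real.exp (-(1 / 4)) ≤ mixtureDensity ν s ξ := by
  have h1 : HasIntegral ν (fun x ↦ (inner ℝ (diagMap s x) ξ : ℝ)) 0 :=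
    (h.hasIntegral_clm ((innerSL ℝ ξ).comp (diagMap s))).congr
      (fun x ↦ by simp [innerSL_apply_apply, real_inner_comm]) rfl
  have h2 := ((hasIntegral_const (μ := ν) (1 : ℝ)).add h1).const_mul (Real.exp (-(1 / 4)))
  rw [add_zero, mul_one] at h2
  rw [← h2.2]
  refine integral_mono_ae h2.1 (integrable_gaussTilt_diagMap h hsβ ξ) ?_
  filter_upwards [h.bound] with x hx
  have h3 := norm_diagMap_sq_le_half hsβ hx
  have h4 := Real.add_one_le_exp (inner ℝ (diagMap s x) ξ : ℝ)
  unfold gaussTilt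
  calc _ ≤ Real.exp (-(1 / 4)) * Real.exp (inner ℝ (diagMap s x) ξ) := by gcongr; linarith
    _ ≤ _ := by rw [← Real.exp_add]; gcongr; linarith

end Velocity

lemma integral_prod_add_stdGaussian {d : ℕ} (ν : Measure (EuclideanSpace ℝ (Fin d)))
    [IsProbabilityMeasure ν] {V : Type*} [NormedAddCommGroup V] [NormedSpace ℝ V]
    {a : EuclideanSpace ℝ (Fin d) → EuclideanSpace ℝ (Fin d)}
    (ha : Measurable a) {H : EuclideanSpace ℝ (Fin d) × EuclideanSpace ℝ (Fin d) → V}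
    (hH : StronglyMeasurable H)
    (hi : Integrable (fun z ↦ H (z.1 + a z.2, z.2))
      ((stdGaussian (EuclideanSpace ℝ (Fin d))).prod ν)) :
    ∫ z, H (z.1 + a z.2, z.2) ∂((stdGaussian (EuclideanSpace ℝ (Fin d))).prod ν) =
      ∫ ξ, ∫ x, gaussTilt (a x) ξ • H (ξ, x) ∂ν ∂(stdGaussian (EuclideanSpace ℝ (Fin d))) := by
  have hT : Measurable fun z : EuclideanSpace ℝ (Fin d) × EuclideanSpace ℝ (Fin d) ↦
      (z.1 + a z.2, z.2) := by fun_prop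
  have hD : Measurable fun z : EuclideanSpace ℝ (Fin d) × EuclideanSpace ℝ (Fin d) ↦
      ENNReal.ofReal (gaussTilt (a z.2) z.1) := by fun_prop
  have hi' := (integrable_map_measure hH.aestronglyMeasurable hT.aemeasurable).2 hi
  rw [map_prod_add_stdGaussian ν ha, integrable_withDensity_iff_integrable_smul' hD
      (Filter.Eventually.of_forall fun _ ↦ ENNReal.ofReal_lt_top)] at hi'
  simp only [ENNReal.toReal_ofReal (gaussTilt_pos _ _).le] at hi'
  rw [← integral_map hT.aemeasurable hH.aestronglyMeasurable, map_prod_add_stdGaussian ν ha,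
    integral_withDensity_eq_integral_toReal_smul hD
      (Filter.Eventually.of_forall fun _ ↦ ENNReal.ofReal_lt_top)]
  simp only [ENNReal.toReal_ofReal (gaussTilt_pos _ _).le]
  rw [integral_prod _ hi']

lemma lintegral_prod_add_stdGaussian {d : ℕ} (ν : Measure (EuclideanSpace ℝ (Fin d)))
    [IsProbabilityMeasure ν] {a : EuclideanSpace ℝ (Fin d) → EuclideanSpace ℝ (Fin d)}
    (ha : Measurable a) {f : EuclideanSpace ℝ (Fin d) → ℝ≥0∞} (hf : Measurable f) :
    ∫⁻ z, f (z.1 + a z.2) ∂((stdGaussian (EuclideanSpace ℝ (Fin d))).prod ν) =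
      ∫⁻ ξ, (∫⁻ x, ENNReal.ofReal (gaussTilt (a x) ξ) ∂ν) * f ξ
        ∂(stdGaussian (EuclideanSpace ℝ (Fin d))) := by
  have hT : Measurable fun z : EuclideanSpace ℝ (Fin d) × EuclideanSpace ℝ (Fin d) ↦
      (z.1 + a z.2, z.2) := by fun_prop
  have hD : Measurable fun z : EuclideanSpace ℝ (Fin d) × EuclideanSpace ℝ (Fin d) ↦
      ENNReal.ofReal (gaussTilt (a z.2) z.1) := by fun_prop
  have hf1 : Measurable fun z : EuclideanSpace ℝ (Fin d) × EuclideanSpace ℝ (Fin d) ↦ f z.1 :=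
    hf.comp measurable_fst
  calc _ = ∫⁻ w, f w.1 ∂(((stdGaussian (EuclideanSpace ℝ (Fin d))).prod ν).map
        (fun z ↦ (z.1 + a z.2, z.2))) := (lintegral_map hf1 hT).symm
    _ = ∫⁻ w, ENNReal.ofReal (gaussTilt (a w.2) w.1) * f w.1
        ∂((stdGaussian (EuclideanSpace ℝ (Fin d))).prod ν) := by
      rw [map_prod_add_stdGaussian ν ha, lintegral_withDensity_eq_lintegral_mul _ hD hf1]
      rfl
    _ = _ := by
      rw [lintegral_prod (fun w ↦ ENNReal.ofReal (gaussTilt (a w.2) w.1) * f w.1)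
        (hD.mul hf1).aemeasurable]
      refine lintegral_congr fun ξ ↦ ?_
      exact lintegral_mul_const (f ξ) (f := fun x ↦ ENNReal.ofReal (gaussTilt (a x) ξ))
        (by fun_prop)

/-- The conditional mean velocity of the interpolation between `x` and a Gaussian vector. -/
lemma exists_velocity {d : ℕ} {ν : Measure (EuclideanSpace ℝ (Fin d))} [IsProbabilityMeasure ν]
    {σ A : Fin d → ℝ} {β q c : ℝ} (h : IsCenteredBounded ν σ β) (hβ : 0 < β)
    (hA : ∀ j, 0 < A j) (hAβ : ∀ j, 2 * β ^ 2 ≤ A j ^ 2) (hAσ : ∀ j, σ j ≤ q * A j ^ 2)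
    (hq0 : 0 ≤ q) (hq : q ≤ 1 / 2) (hc0 : 0 ≤ c) (hc1 : c ≤ 1) :
    ∃ u : EuclideanSpace ℝ (Fin d) → EuclideanSpace ℝ (Fin d), Measurable u ∧
      eLpNorm (fun z ↦ u (diagMap A z.1 + c • z.2)) 2
        ((stdGaussian (EuclideanSpace ℝ (Fin d))).prod ν) ≤
          ENNReal.ofReal (13 / 5 * β * √d * q) ∧
      ∀ ψ : EuclideanSpace ℝ (Fin d) → ℝ, Measurable ψ → (∀ y, |ψ y| ≤ 1) →
        ∫ z, ψ (diagMap A z.1 + c • z.2) • (diagMap (fun j ↦ c * σ j / A j) z.1 - z.2 -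
          u (diagMap A z.1 + c • z.2)) ∂((stdGaussian (EuclideanSpace ℝ (Fin d))).prod ν) = 0 := by
  -- With this scaling, A G + c X = A (G + s X), and G + s X has density `mixtureDensity ν s`
  -- relative to the standard Gaussian.
  set s : Fin d → ℝ := fun j ↦ c / A j with hs
  have hc2 : c ^ 2 ≤ 1 := pow_le_one₀ hc0 hc1
  have hsβ : ∀ j, s j ^ 2 * (2 * β ^ 2) ≤ 1 := by
    intro j
    have := hA j
    rw [hs]
    simp only
    rw [div_pow, div_mul_eq_mul_div, div_le_one (by positivity)]
    nlinarith [hAβ j, sq_nonneg β]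
  have hsσ : ∀ j, s j ^ 2 * σ j ≤ q := by
    intro j
    have := hA j
    have h0 := h.variance_nonneg j
    rw [hs]
    simp only
    rw [div_pow, div_mul_eq_mul_div, div_le_iff₀ (by positivity)]
    nlinarith [hAσ j]
  have hm : (fun j ↦ c * σ j / A j) = fun j ↦ s j * σ j := by
    ext j; rw [hs]; ring
  rw [hm]
  -- Bayes' formula for the conditional mean of the velocity given G + s X = ξ, where G is read as ξ
  -- - s X.
  set w : EuclideanSpace ℝ (Fin d) → EuclideanSpace ℝ (Fin d) := fun ξ ↦
    (mixtureDensity ν s ξ)⁻¹ • velocityNumerator ν σ s ξ with hw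
  have hwm : Measurable w :=
    (measurable_mixtureDensity ν s).inv.smul (measurable_velocityNumerator ν σ s)
  have hY : ∀ z : EuclideanSpace ℝ (Fin d) × EuclideanSpace ℝ (Fin d),
      diagMap A z.1 + c • z.2 = diagMap A (z.1 + diagMap s z.2) := by
    intro z
    ext j
    have := (hA j).ne'
    simp only [PiLp.add_apply, PiLp.smul_apply, diagMap_apply, smul_eq_mul, hs]
    field_simp
  have hinv : ∀ ζ : EuclideanSpace ℝ (Fin d), diagMap (fun j ↦ (A j)⁻¹) (diagMap A ζ) = ζ := by
    intro ζ
    ext j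
    have := (hA j).ne'
    simp only [diagMap_apply]
    field_simp
  have hmix : ∀ ξ, 0 < mixtureDensity ν s ξ := fun ξ ↦
    (Real.exp_pos _).trans_le (exp_neg_quarter_le_mixtureDensity h hsβ ξ)
  -- Integrating ‖w‖² against the mixture density cancels one of its two denominators; the lower
  -- bound on the density controls the other.
  have hL2 : ∫⁻ z, ENNReal.ofReal (‖w (z.1 + diagMap s z.2)‖ ^ 2)
      ∂((stdGaussian (EuclideanSpace ℝ (Fin d))).prod ν) ≤
        ENNReal.ofReal ((13 / 5 * β * √d * q) ^ 2) := by
    rw [lintegral_prod_add_stdGaussian ν (by fun_prop)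
      (f := fun ξ ↦ ENNReal.ofReal (‖w ξ‖ ^ 2)) (by fun_prop)]
    calc _ ≤ ∫⁻ ξ, ENNReal.ofReal (Real.exp (1 / 4)) *
          ENNReal.ofReal (‖velocityNumerator ν σ s ξ‖ ^ 2)
          ∂(stdGaussian (EuclideanSpace ℝ (Fin d))) := by
          refine lintegral_mono fun ξ ↦ ?_
          rw [← ofReal_integral_eq_lintegral_ofReal (integrable_gaussTilt_diagMap h hsβ ξ)
            (Filter.Eventually.of_forall fun x ↦ (gaussTilt_pos _ _).le)]
          change ENNReal.ofReal (mixtureDensity ν s ξ) * _ ≤ _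
          rw [← ENNReal.ofReal_mul (hmix ξ).le, ← ENNReal.ofReal_mul (Real.exp_pos _).le]
          refine ENNReal.ofReal_le_ofReal ?_
          have hx := hmix ξ
          have e : mixtureDensity ν s ξ * ‖w ξ‖ ^ 2 =
              (mixtureDensity ν s ξ)⁻¹ * ‖velocityNumerator ν σ s ξ‖ ^ 2 := by
            rw [hw]
            simp only
            rw [norm_smul, Real.norm_of_nonneg (inv_pos.2 hx).le]
            field_simp
          rw [e]
          gcongr
          rw [← neg_neg (1 / 4 : ℝ), Real.exp_neg (-(1 / 4))]
          exact inv_anti₀ (Real.exp_pos _) (exp_neg_quarter_le_mixtureDensity h hsβ ξ)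
      _ ≤ ENNReal.ofReal (Real.exp (1 / 4)) * ENNReal.ofReal (5 * β ^ 2 * (d * q ^ 2)) := by
          rw [lintegral_const_mul _
            (((measurable_velocityNumerator ν σ s).norm.pow_const 2).ennreal_ofReal)]
          gcongr
          exact lintegral_enorm_velocityNumerator_sq_le h hβ hsβ hsσ hq
      _ ≤ _ := by
          rw [← ENNReal.ofReal_mul (Real.exp_pos _).le]
          refine ENNReal.ofReal_le_ofReal ?_
          -- The value 1.352 is chosen so that 5 · 1.352 = (13/5)².
          have h1 : Real.exp (1 / 4) ≤ 1.352 := by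
            have h4 : Real.exp (1 / 4) ^ 4 = Real.exp 1 := by
              rw [← Real.exp_nat_mul]; norm_num
            refine le_of_pow_le_pow_left₀ (n := 4) (by norm_num) (by norm_num) ?_
            rw [h4]
            exact Real.exp_one_lt_d9.le.trans (by norm_num)
          have h2 : (13 / 5 * β * √d * q) ^ 2 = 1.352 * (5 * β ^ 2 * (d * q ^ 2)) := by
            rw [mul_pow, mul_pow, mul_pow, Real.sq_sqrt (Nat.cast_nonneg d)]; norm_num; ring
          rw [h2]
          gcongr
  have hnorm : eLpNorm (fun z : EuclideanSpace ℝ (Fin d) × EuclideanSpace ℝ (Fin d) ↦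
      w (z.1 + diagMap s z.2)) 2 ((stdGaussian (EuclideanSpace ℝ (Fin d))).prod ν) ≤
        ENNReal.ofReal (13 / 5 * β * √d * q) := by
    rw [eLpNorm_eq_lintegral_rpow_enorm_toReal (by norm_num) (by norm_num)]
    have e : ∀ z : EuclideanSpace ℝ (Fin d) × EuclideanSpace ℝ (Fin d),
        ‖w (z.1 + diagMap s z.2)‖ₑ ^ (2 : ℝ≥0∞).toReal =
          ENNReal.ofReal (‖w (z.1 + diagMap s z.2)‖ ^ 2) := by
      intro z
      rw [ENNReal.ofReal_pow (norm_nonneg _), ofReal_norm]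
      simp
    simp_rw [e]
    refine (ENNReal.rpow_le_rpow hL2 (by positivity)).trans (le_of_eq ?_)
    rw [ENNReal.ofReal_pow (by positivity), ← ENNReal.rpow_natCast, ← ENNReal.rpow_mul]
    simp
  have hwint : MemLp (fun z : EuclideanSpace ℝ (Fin d) × EuclideanSpace ℝ (Fin d) ↦
      w (z.1 + diagMap s z.2)) 2 ((stdGaussian (EuclideanSpace ℝ (Fin d))).prod ν) :=
    ⟨Measurable.aestronglyMeasurable (by fun_prop), hnorm.trans_lt ENNReal.ofReal_lt_top⟩
  refine ⟨fun y ↦ w (diagMap (fun j ↦ (A j)⁻¹) y), by fun_prop, ?_, fun ψ hψ hψ1 ↦ ?_⟩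
  · simp_rw [hY, hinv]
    exact hnorm
  · simp_rw [hY, hinv]
    set H₁ : EuclideanSpace ℝ (Fin d) × EuclideanSpace ℝ (Fin d) → EuclideanSpace ℝ (Fin d) :=
      fun z ↦ ψ (diagMap A z.1) • (diagMap (fun j ↦ s j * σ j) (z.1 - diagMap s z.2) - z.2)
      with hH₁
    set H₂ : EuclideanSpace ℝ (Fin d) × EuclideanSpace ℝ (Fin d) → EuclideanSpace ℝ (Fin d) :=
      fun z ↦ ψ (diagMap A z.1) • w z.1 with hH₂
    have m1 : Measurable H₁ := by rw [hH₁]; fun_prop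
    have m2 : Measurable H₂ := by rw [hH₂]; fun_prop
    have i1 : Integrable (fun z ↦ H₁ (z.1 + diagMap s z.2, z.2))
        ((stdGaussian (EuclideanSpace ℝ (Fin d))).prod ν) := by
      have j1 := ((hasIntegral_clm_stdGaussian (diagMap (d := d) fun j ↦ s j * σ j)).1.comp_fst
        ν).sub (h.hasIntegral_id.1.comp_snd (stdGaussian (EuclideanSpace ℝ (Fin d))))
      refine (j1.bdd_smul (φ := fun z : EuclideanSpace ℝ (Fin d) × EuclideanSpace ℝ (Fin d) ↦
        ψ (diagMap A (z.1 + diagMap s z.2))) 1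
        (Measurable.aestronglyMeasurable (by fun_prop))
        (Filter.Eventually.of_forall fun z ↦ hψ1 _)).congr (Filter.Eventually.of_forall fun z ↦ ?_)
      simp [hH₁]
    have i2 : Integrable (fun z ↦ H₂ (z.1 + diagMap s z.2, z.2))
        ((stdGaussian (EuclideanSpace ℝ (Fin d))).prod ν) :=
      (hwint.integrable (by norm_num)).bdd_smul
        (φ := fun z : EuclideanSpace ℝ (Fin d) × EuclideanSpace ℝ (Fin d) ↦
        ψ (diagMap A (z.1 + diagMap s z.2))) 1
        (Measurable.aestronglyMeasurable (by fun_prop))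
        (Filter.Eventually.of_forall fun z ↦ hψ1 _)
    have e : ∀ z : EuclideanSpace ℝ (Fin d) × EuclideanSpace ℝ (Fin d),
        ψ (diagMap A (z.1 + diagMap s z.2)) • (diagMap (fun j ↦ s j * σ j) z.1 - z.2 -
          w (z.1 + diagMap s z.2)) =
        H₁ (z.1 + diagMap s z.2, z.2) - H₂ (z.1 + diagMap s z.2, z.2) := by
      intro z
      simp [hH₁, hH₂, smul_sub]
    simp_rw [e]
    rw [integral_sub i1 i2, integral_prod_add_stdGaussian ν (by fun_prop) m1.stronglyMeasurable i1,
      integral_prod_add_stdGaussian ν (by fun_prop) m2.stronglyMeasurable i2, sub_eq_zero]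
    refine integral_congr_ae (Filter.Eventually.of_forall fun ξ ↦ ?_)
    simp only [hH₁, hH₂]
    rw [integral_smul_const]
    change _ = mixtureDensity ν s ξ • ψ (diagMap A ξ) • w ξ
    simp_rw [smul_comm (gaussTilt _ ξ) (ψ (diagMap A ξ))]
    rw [integral_smul, smul_comm (mixtureDensity ν s ξ), hw]
    simp only
    rw [smul_inv_smul₀ (hmix ξ).ne']
    rfl

/-! ### Replacing a displacement by its conditional mean -/

lemma eLpNorm_two_eq_of_hasIntegral {α V : Type*} [MeasurableSpace α] [NormedAddCommGroup V]
    {μ : Measure α} {f : α → V} {v : ℝ} (h : HasIntegral μ (fun x ↦ ‖f x‖ ^ 2) v) :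
    eLpNorm f 2 μ = ENNReal.ofReal √v := by
  rw [eLpNorm_eq_lintegral_rpow_enorm_toReal (by norm_num) (by norm_num)]
  have e : ∀ x, ‖f x‖ₑ ^ (2 : ℝ≥0∞).toReal = ENNReal.ofReal (‖f x‖ ^ 2) := by
    intro x
    rw [ENNReal.ofReal_pow (norm_nonneg _), ofReal_norm]
    simp
  simp_rw [e]
  rw [← ofReal_integral_eq_lintegral_ofReal h.1
    (Filter.Eventually.of_forall fun x ↦ by positivity), h.2, ENNReal.ofReal_rpow_of_nonneg
    (h.2 ▸ integral_nonneg fun x ↦ by positivity) (by positivity), Real.sqrt_eq_rpow]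
  simp

lemma integral_norm_sq_le_of_eLpNorm_le {α V : Type*} [MeasurableSpace α] [NormedAddCommGroup V]
    {μ : Measure α} {f : α → V} (hf : AEStronglyMeasurable f μ) {a : ℝ} (ha : 0 ≤ a)
    (h : eLpNorm f 2 μ ≤ ENNReal.ofReal a) :
    Integrable (fun x ↦ ‖f x‖ ^ 2) μ ∧ ∫ x, ‖f x‖ ^ 2 ∂μ ≤ a ^ 2 := by
  have hm : MemLp f 2 μ := ⟨hf, h.trans_lt ENNReal.ofReal_lt_top⟩
  have hi : Integrable (fun x ↦ ‖f x‖ ^ 2) μ := (memLp_two_iff_integrable_sq_norm hf).1 hm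
  refine ⟨hi, ?_⟩
  rw [eLpNorm_two_eq_of_hasIntegral ⟨hi, rfl⟩, ENNReal.ofReal_le_ofReal_iff ha] at h
  rwa [Real.sqrt_le_left ha] at h

lemma eLpNorm_id_stdGaussian (d : ℕ) :
    eLpNorm (fun ξ ↦ ξ) 2 (stdGaussian (EuclideanSpace ℝ (Fin d))) = ENNReal.ofReal √d := by
  refine eLpNorm_two_eq_of_hasIntegral ((hasIntegral_diagMap_inner_self (fun _ ↦ 1)).congr
    (fun ξ ↦ ?_) (by simp))
  rw [real_inner_self_eq_norm_sq, norm_diagMap_sq, EuclideanSpace.real_norm_sq_eq]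
  simp

lemma norm_diagMap_le {d : ℕ} {f : Fin d → ℝ} {κ : ℝ} (hκ : 0 ≤ κ) (hf : ∀ j, |f j| ≤ κ)
    (x : EuclideanSpace ℝ (Fin d)) : ‖diagMap f x‖ ≤ κ * ‖x‖ := by
  refine (pow_le_pow_iff_left₀ (norm_nonneg _) (by positivity) two_ne_zero).1 ?_
  rw [norm_diagMap_sq, mul_pow, EuclideanSpace.real_norm_sq_eq, Finset.mul_sum]
  exact Finset.sum_le_sum fun j _ ↦ mul_le_mul_of_nonneg_right
    (sq_le_sq' (neg_le_of_abs_le (hf j)) (le_of_abs_le (hf j))) (sq_nonneg _)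

lemma eLpNorm_diagMap_stdGaussian_le {d : ℕ} {f : Fin d → ℝ} {κ : ℝ} (hκ : 0 ≤ κ)
    (hf : ∀ j, |f j| ≤ κ) :
    eLpNorm (fun ξ ↦ diagMap f ξ) 2 (stdGaussian (EuclideanSpace ℝ (Fin d))) ≤
      ENNReal.ofReal (κ * √d) := by
  refine (eLpNorm_le_mul_eLpNorm_of_ae_le_mul (g := fun ξ : EuclideanSpace ℝ (Fin d) ↦ ξ) (c := κ)
    (Filter.Eventually.of_forall fun ξ ↦ norm_diagMap_le hκ hf ξ) 2).trans (le_of_eq ?_)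
  rw [eLpNorm_id_stdGaussian, ENNReal.ofReal_mul hκ]

/-- Replacing a displacement by its conditional mean costs second order in total variation, in the
presence of independent Gaussian noise. -/
lemma partialTransport_of_condMean {Ω : Type*} [MeasurableSpace Ω] {d : ℕ} (P : Measure Ω)
    [IsProbabilityMeasure P] {Y V U : Ω → EuclideanSpace ℝ (Fin d)} (hY : Measurable Y)
    (hV : Measurable V) (hU : Measurable U) {a b ρ : ℝ} (ha : 0 ≤ a) (hb : 0 ≤ b) (hρ : 0 < ρ)
    (hVa : eLpNorm V 2 P ≤ ENNReal.ofReal a) (hUb : eLpNorm U 2 P ≤ ENNReal.ofReal b)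
    (hcond : ∀ ψ : EuclideanSpace ℝ (Fin d) → ℝ, Measurable ψ → (∀ y, |ψ y| ≤ 1) →
      ∫ ω, ψ (Y ω) • (V ω - U ω) ∂P = 0) (h : ℝ) :
    PartialTransport
      ((P.prod (stdGaussian (EuclideanSpace ℝ (Fin d)))).map
        (fun w ↦ Y w.1 + ρ • w.2 + h • U w.1))
      ((P.prod (stdGaussian (EuclideanSpace ℝ (Fin d)))).map
        (fun w ↦ Y w.1 + ρ • w.2 + h • V w.1)) 0
      (ENNReal.ofReal (3 * (h / ρ) ^ 2 * (a ^ 2 + b ^ 2))) := by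
  set γ := stdGaussian (EuclideanSpace ℝ (Fin d)) with hγ
  set k := h / ρ with hk
  have hmap : ∀ W : Ω → EuclideanSpace ℝ (Fin d), Measurable W → IsProbabilityMeasure
      ((P.prod γ).map (fun w ↦ Y w.1 + ρ • w.2 + h • W w.1)) := fun W hW ↦
    Measure.isProbabilityMeasure_map (by fun_prop)
  have := hmap V hV
  have := hmap U hU
  refine partialTransport_of_measure_le fun S hS ↦ ?_
  set φ : EuclideanSpace ℝ (Fin d) → ℝ := S.indicator 1 with hφ
  have hφm : Measurable φ := measurable_one.indicator hS
  have hφ1 : ∀ y, |φ y| ≤ 1 := by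
    intro y
    by_cases hy : y ∈ S <;> simp [hφ, hy]
  have hφ0 : ∀ y, 0 ≤ φ y := fun y ↦ Set.indicator_nonneg (fun _ _ ↦ zero_le_one) y
  have hreal : ∀ W : Ω → EuclideanSpace ℝ (Fin d), Measurable W →
      HasIntegral P (fun ω ↦ ∫ g, φ (Y ω + ρ • g + h • W ω) ∂γ)
        (((P.prod γ).map (fun w ↦ Y w.1 + ρ • w.2 + h • W w.1)).real S) := by
    intro W hW
    have hF : Measurable fun w : Ω × EuclideanSpace ℝ (Fin d) ↦
      Y w.1 + ρ • w.2 + h • W w.1 := by fun_prop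
    have hi : Integrable (fun w : Ω × EuclideanSpace ℝ (Fin d) ↦
        φ (Y w.1 + ρ • w.2 + h • W w.1)) (P.prod γ) :=
      Integrable.of_bound (Measurable.aestronglyMeasurable (by fun_prop)) 1
        (Filter.Eventually.of_forall fun w ↦ hφ1 _)
    refine ⟨hi.integral_prod_left, ?_⟩
    rw [← integral_indicator_one hS, integral_map hF.aemeasurable hφm.aestronglyMeasurable,
      integral_prod _ hi]
  have hbdd : ∀ {f : EuclideanSpace ℝ (Fin d) → ℝ}, Integrable f γ → ∀ y,
      Integrable (fun g ↦ f g * φ (y + ρ • g)) γ := by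
    intro f hf y
    exact hf.mul_bdd (c := 1) (Measurable.aestronglyMeasurable (by fun_prop))
      (Filter.Eventually.of_forall fun g ↦ hφ1 _)
  -- Cameron–Martin in the noise variable moves the displacement off the discontinuous `φ` onto a
  -- smooth density, expanded to first order.
  have hshift : ∀ y v : EuclideanSpace ℝ (Fin d), ∫ g, φ (y + ρ • g + h • v) ∂γ =
      ∫ g, φ (y + ρ • g) ∂γ + ∫ g, (inner ℝ (k • v) g : ℝ) * φ (y + ρ • g) ∂γ +
        ∫ g, gaussRem (k • v) g * φ (y + ρ • g) ∂γ := by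
    intro y v
    have e1 : ∫ g, φ (y + ρ • g + h • v) ∂γ = ∫ g, gaussTilt (k • v) g * φ (y + ρ • g) ∂γ := by
      have := integral_add_stdGaussian (k • v) (fun g ↦ φ (y + ρ • g))
      simp only [smul_eq_mul] at this
      rw [this]
      refine integral_congr_ae (Filter.Eventually.of_forall fun g ↦ ?_)
      simp only
      rw [smul_add, smul_smul, hk, mul_div_cancel₀ _ hρ.ne', add_assoc]
    have i1 : Integrable (fun g ↦ φ (y + ρ • g)) γ := by
      simpa using hbdd (integrable_const (1 : ℝ)) y
    have i2 := hbdd (hasIntegral_inner_stdGaussian (k • v)).1 y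
    have i3 := hbdd (integrable_gaussRem (k • v)) y
    rw [e1, ← integral_add i1 i2, ← integral_add (show Integrable (fun g ↦ φ (y + ρ • g) +
      (inner ℝ (k • v) g : ℝ) * φ (y + ρ • g)) γ from i1.add i2) i3]
    refine integral_congr_ae (Filter.Eventually.of_forall fun g ↦ ?_)
    simp only [gaussRem]
    ring
  have hrem : ∀ y v : EuclideanSpace ℝ (Fin d),
      |∫ g, gaussRem (k • v) g * φ (y + ρ • g) ∂γ| ≤ 3 * k ^ 2 * ‖v‖ ^ 2 := by
    intro y v
    calc _ ≤ ∫ g, |gaussRem (k • v) g| ∂γ := by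
          rw [← Real.norm_eq_abs]
          refine (norm_integral_le_of_norm_le (integrable_gaussRem (k • v)).abs
            (Filter.Eventually.of_forall fun g ↦ ?_))
          rw [norm_mul]
          exact mul_le_of_le_one_right (abs_nonneg _) (hφ1 _)
      _ ≤ 3 * ‖k • v‖ ^ 2 := integral_abs_gaussRem_le _
      _ = _ := by rw [norm_smul, mul_pow, Real.norm_eq_abs, sq_abs]; ring
  have hVi := integral_norm_sq_le_of_eLpNorm_le hV.aestronglyMeasurable ha hVa
  have hUi := integral_norm_sq_le_of_eLpNorm_le hU.aestronglyMeasurable hb hUb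
  have hV1 : Integrable V P := MemLp.integrable (q := 2) (by norm_num)
    ⟨hV.aestronglyMeasurable, hVa.trans_lt ENNReal.ofReal_lt_top⟩
  have hU1 : Integrable U P := MemLp.integrable (q := 2) (by norm_num)
    ⟨hU.aestronglyMeasurable, hUb.trans_lt ENNReal.ofReal_lt_top⟩
  -- After exchanging the integrals, g is fixed and `φ (· + ρ • g)` is an admissible test function
  -- for the conditional mean, so the first-order terms of `V` and `U` agree.
  have hlin : HasIntegral P
      (fun ω ↦ ∫ g, (inner ℝ (k • (V ω - U ω)) g : ℝ) * φ (Y ω + ρ • g) ∂γ) 0 := by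
    have hi : Integrable (Function.uncurry fun (ω : Ω) (g : EuclideanSpace ℝ (Fin d)) ↦
        (inner ℝ (k • (V ω - U ω)) g : ℝ) * φ (Y ω + ρ • g)) (P.prod γ) := by
      have hd := (((hV1.sub hU1).smul k).norm).mul_prod
        ((hasIntegral_clm_stdGaussian (ContinuousLinearMap.id ℝ
          (EuclideanSpace ℝ (Fin d)))).1.norm)
      refine hd.mono' (Measurable.aestronglyMeasurable (by unfold Function.uncurry; fun_prop))
        (Filter.Eventually.of_forall fun w ↦ ?_)
      simp only [Function.uncurry, norm_mul]
      calc _ ≤ ‖(inner ℝ (k • (V w.1 - U w.1)) w.2 : ℝ)‖ * 1 := by gcongr; exact hφ1 _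
        _ ≤ _ := by rw [mul_one]; exact abs_real_inner_le_norm _ _
    refine ⟨hi.integral_prod_left, ?_⟩
    rw [integral_integral_swap hi]
    refine integral_eq_zero_of_ae (Filter.Eventually.of_forall fun g ↦ ?_)
    have hc := hcond (fun y ↦ φ (y + ρ • g)) (by fun_prop) (fun y ↦ hφ1 _)
    have hci : Integrable (fun ω ↦ φ (Y ω + ρ • g) • (V ω - U ω)) P :=
      (hV1.sub hU1).bdd_smul 1 (φ := fun ω ↦ φ (Y ω + ρ • g))
        (Measurable.aestronglyMeasurable (by fun_prop))
        (Filter.Eventually.of_forall fun ω ↦ hφ1 _)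
    have := integral_inner (𝕜 := ℝ) hci (k • g)
    rw [hc, inner_zero_right] at this
    simp only [Pi.zero_apply]
    rw [← this]
    refine integral_congr_ae (Filter.Eventually.of_forall fun ω ↦ ?_)
    simp only
    rw [real_inner_smul_left, real_inner_smul_left, real_inner_smul_right, real_inner_comm g]
    ring
  have hmain : ((P.prod γ).map (fun w ↦ Y w.1 + ρ • w.2 + h • U w.1)).real S ≤
      ((P.prod γ).map (fun w ↦ Y w.1 + ρ • w.2 + h • V w.1)).real S +
        3 * k ^ 2 * (a ^ 2 + b ^ 2) := by
    have hsq : HasIntegral P (fun ω ↦ 3 * k ^ 2 * (‖V ω‖ ^ 2 + ‖U ω‖ ^ 2))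
        (3 * k ^ 2 * (∫ ω, ‖V ω‖ ^ 2 ∂P + ∫ ω, ‖U ω‖ ^ 2 ∂P)) :=
      ((show HasIntegral P _ _ from ⟨hVi.1, rfl⟩).add
        (show HasIntegral P _ _ from ⟨hUi.1, rfl⟩)).const_mul _
    have hright := ((hreal V hV).sub hlin).add hsq
    have hle := integral_mono (hreal U hU).1 hright.1 (fun ω ↦ ?_)
    · rw [(hreal U hU).2, hright.2] at hle
      refine hle.trans ?_
      rw [sub_zero]
      gcongr
      · exact hVi.2
      · exact hUi.2
    · simp only
      rw [hshift, hshift]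
      have r1 := hrem (Y ω) (V ω)
      have r2 := hrem (Y ω) (U ω)
      have e : ∫ g, (inner ℝ (k • (V ω - U ω)) g : ℝ) * φ (Y ω + ρ • g) ∂γ =
          ∫ g, (inner ℝ (k • V ω) g : ℝ) * φ (Y ω + ρ • g) ∂γ -
          ∫ g, (inner ℝ (k • U ω) g : ℝ) * φ (Y ω + ρ • g) ∂γ := by
        rw [← integral_sub (hbdd (hasIntegral_inner_stdGaussian (k • V ω)).1 _)
          (hbdd (hasIntegral_inner_stdGaussian (k • U ω)).1 _)]
        refine integral_congr_ae (Filter.Eventually.of_forall fun g ↦ ?_)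
        simp only
        rw [smul_sub, inner_sub_left, sub_mul]
      rw [e]
      rw [abs_le] at r1 r2
      linarith
  rw [← ofReal_measureReal (μ := (P.prod γ).map (fun w ↦ Y w.1 + ρ • w.2 + h • U w.1)),
    ← ofReal_measureReal (μ := (P.prod γ).map (fun w ↦ Y w.1 + ρ • w.2 + h • V w.1)),
    ← ENNReal.ofReal_add measureReal_nonneg (by positivity)]
  exact ENNReal.ofReal_le_ofReal hmain

/-- Error of one Euler step for the scale, whose time derivative is cσ/a. Multiplied by a(a' + a),
the error equals hσ(c(a' - a) + ha), and a' - a ≤ hβ ≤ ha makes this second order in h. -/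
lemma abs_add_mul_div_sub_le {B σ β c h a a' : ℝ} (hβ : 0 < β) (hσ0 : 0 ≤ σ) (hσ : σ ≤ β ^ 2)
    (hh : 0 ≤ h) (hhc : h ≤ c) (hc1 : c ≤ 1) (haβ : β ≤ a) (haβ' : β ≤ a')
    (ha : a ^ 2 = B + (1 - c ^ 2) * σ) (ha' : a' ^ 2 = B + (1 - (c - h) ^ 2) * σ) :
    |a + h * (c * σ / a) - a'| ≤ h ^ 2 * β := by
  have ha0 : 0 < a := hβ.trans_le haβ
  have ha0' : 0 < a' := hβ.trans_le haβ'
  have hc0 : 0 ≤ c := hh.trans hhc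
  have hd : (a' - a) * (a' + a) = h * (2 * c - h) * σ := by linear_combination ha' - ha
  have hn : 0 ≤ a' - a := by
    have : 0 ≤ (a' - a) * (a' + a) := by
      rw [hd]; exact mul_nonneg (mul_nonneg hh (by linarith)) hσ0
    exact nonneg_of_mul_nonneg_left this (by positivity)
  have hsum : 2 * β ≤ a' + a := by linarith
  have e : (a + h * (c * σ / a) - a') * (a * (a' + a)) = h * σ * (c * (a' - a) + h * a) := by
    field_simp
    linear_combination (-a) * hd
  have hpos : 0 < a * (a' + a) := by positivity
  have hup : a' - a ≤ h * a := by
    have h1 : (a' - a) * (2 * β) ≤ 2 * h * β ^ 2 :=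
      calc (a' - a) * (2 * β) ≤ (a' - a) * (a' + a) := by gcongr
        _ = h * (2 * c - h) * σ := hd
        _ ≤ h * 2 * β ^ 2 := by gcongr; linarith
        _ = _ := by ring
    have h2 : (a' - a) * (2 * β) ≤ (h * β) * (2 * β) := by linarith
    exact (le_of_mul_le_mul_right h2 (by positivity)).trans (by gcongr)
  rw [abs_of_nonneg]
  · refine le_of_mul_le_mul_right ?_ hpos
    rw [e]
    calc h * σ * (c * (a' - a) + h * a) ≤ h * β ^ 2 * (1 * (h * a) + h * a) := by gcongr
      _ = h ^ 2 * β * (a * (2 * β)) := by ring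
      _ ≤ _ := by gcongr
  · refine nonneg_of_mul_nonneg_left (b := a * (a' + a)) ?_ hpos
    rw [e]
    positivity

/-! ### The discretised interpolation path -/

/-- The standard deviation at time `t` of the Gaussian part of the interpolation. -/
noncomputable def pathScale {d : ℕ} (B σ : Fin d → ℝ) (t : ℝ) (j : Fin d) : ℝ :=
  √(B j + (1 - (1 - t) ^ 2) * σ j)

/-- The interpolation between `ν` and a Gaussian, smoothed by two independent Gaussians. -/
noncomputable def pathLaw {d : ℕ} (ν : Measure (EuclideanSpace ℝ (Fin d))) (B σ : Fin d → ℝ)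
    (ρ t : ℝ) : Measure (EuclideanSpace ℝ (Fin d)) :=
  (((stdGaussian (EuclideanSpace ℝ (Fin d))).prod ν).prod
    (stdGaussian (EuclideanSpace ℝ (Fin d)))).map
      (fun w ↦ diagMap (pathScale B σ t) w.1.1 + (1 - t) • w.1.2 + ρ • w.2)

instance {d : ℕ} (ν : Measure (EuclideanSpace ℝ (Fin d))) [IsProbabilityMeasure ν]
    (B σ : Fin d → ℝ) (ρ t : ℝ) : IsProbabilityMeasure (pathLaw ν B σ ρ t) :=
  Measure.isProbabilityMeasure_map (by fun_prop)

section Path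

variable {d : ℕ} {ν : Measure (EuclideanSpace ℝ (Fin d))} [IsProbabilityMeasure ν]
  {σ B : Fin d → ℝ} {β q ρ : ℝ}

/-- Three legs: move by the conditional mean velocity, exchange it for the true velocity, and
correct the curvature of the scale. The middle leg costs only mass; the outer two cost only
distance. -/
lemma pathLaw_step (h : IsCenteredBounded ν σ β) (hβ : 0 < β) (hρ : 0 < ρ)
    (hBβ : ∀ j, 2 * β ^ 2 ≤ B j) (hBσ : ∀ j, σ j ≤ q * B j) (hq0 : 0 ≤ q) (hq : q ≤ 1 / 2)
    {t δ : ℝ} (ht : 0 ≤ t) (hδ : 0 ≤ δ) (htδ : t + δ ≤ 1) :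
    PartialTransport (pathLaw ν B σ ρ t) (pathLaw ν B σ ρ (t + δ))
      (ENNReal.ofReal (δ * (13 / 5 * β * √d * q) + δ ^ 2 * β * √d))
      (ENNReal.ofReal (3 * (δ / ρ) ^ 2 * ((β * √d + β) ^ 2 + (13 / 5 * β * √d * q) ^ 2))) := by
  set γ := stdGaussian (EuclideanSpace ℝ (Fin d)) with hγ
  have hsq : ∀ s, 0 ≤ s → s ≤ 1 → ∀ j,
      pathScale B σ s j ^ 2 = B j + (1 - (1 - s) ^ 2) * σ j ∧ B j ≤ pathScale B σ s j ^ 2 ∧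
        β ≤ pathScale B σ s j := by
    intro s hs0 hs1 j
    have h1 : 0 ≤ (1 - (1 - s) ^ 2) * σ j := by
      refine mul_nonneg ?_ (h.variance_nonneg j)
      nlinarith
    have h2 : 0 ≤ B j := (by positivity : 0 ≤ 2 * β ^ 2).trans (hBβ j)
    have h3 : pathScale B σ s j ^ 2 = B j + (1 - (1 - s) ^ 2) * σ j := Real.sq_sqrt (by positivity)
    refine ⟨h3, by linarith, Real.le_sqrt_of_sq_le ?_⟩
    nlinarith [hBβ j]
  set A := pathScale B σ t with hAdef
  have ht1 : t ≤ 1 := by linarith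
  have hAβ : ∀ j, β ≤ A j := fun j ↦ (hsq t ht ht1 j).2.2
  have hA : ∀ j, 0 < A j := fun j ↦ hβ.trans_le (hAβ j)
  obtain ⟨u, hum, hun, hcond⟩ := exists_velocity (c := 1 - t) h hβ hA
    (fun j ↦ (hBβ j).trans (hsq t ht ht1 j).2.1)
    (fun j ↦ (hBσ j).trans (by gcongr; exact (hsq t ht ht1 j).2.1)) hq0 hq (by linarith)
    (by linarith)
  set M : Fin d → ℝ := fun j ↦ (1 - t) * σ j / A j with hM
  set Y : EuclideanSpace ℝ (Fin d) × EuclideanSpace ℝ (Fin d) → EuclideanSpace ℝ (Fin d) :=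
    fun z ↦ diagMap A z.1 + (1 - t) • z.2 with hY
  set V : EuclideanSpace ℝ (Fin d) × EuclideanSpace ℝ (Fin d) → EuclideanSpace ℝ (Fin d) :=
    fun z ↦ diagMap M z.1 - z.2 with hV
  have hYm : Measurable Y := by fun_prop
  have hVm : Measurable V := by fun_prop
  have hUm : Measurable (fun z ↦ u (Y z)) := by fun_prop
  have hMβ : ∀ j, |M j| ≤ β := by
    intro j
    have h0 := h.variance_nonneg j
    have h1 := hA j
    rw [hM, abs_of_nonneg (by have : 0 ≤ 1 - t := by linarith
                              positivity), div_le_iff₀ h1]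
    calc (1 - t) * σ j ≤ 1 * β ^ 2 := by
          gcongr
          · linarith
          · exact h.variance_le j
      _ = β * β := by ring
      _ ≤ _ := by gcongr; exact hAβ j
  have hVn : eLpNorm V 2 (γ.prod ν) ≤ ENNReal.ofReal (β * √d + β) := by
    have h1 : eLpNorm (fun z : EuclideanSpace ℝ (Fin d) × EuclideanSpace ℝ (Fin d) ↦
        diagMap M z.1) 2 (γ.prod ν) ≤ ENNReal.ofReal (β * √d) :=
      (eLpNorm_comp_measurePreserving (g := fun ξ ↦ diagMap M ξ)
        (Measurable.aestronglyMeasurable (by fun_prop)) measurePreserving_fst).trans_le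
        (eLpNorm_diagMap_stdGaussian_le hβ.le hMβ)
    have h2 : eLpNorm (fun z : EuclideanSpace ℝ (Fin d) × EuclideanSpace ℝ (Fin d) ↦
        z.2) 2 (γ.prod ν) ≤ ENNReal.ofReal β := by
      refine (eLpNorm_comp_measurePreserving (g := fun x ↦ x) (by fun_prop)
        measurePreserving_snd).trans_le ?_
      simpa using eLpNorm_le_of_ae_bound (p := 2) h.bound
    rw [ENNReal.ofReal_add (by positivity) hβ.le]
    exact (eLpNorm_sub_le (by fun_prop) (by fun_prop) (by norm_num)).trans (add_le_add h1 h2)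
  have s2 := partialTransport_of_condMean (γ.prod ν) hYm hVm hUm (by positivity) (by positivity) hρ
    hVn hun hcond δ
  have s1 := partialTransport_map ((γ.prod ν).prod γ)
    (X := fun w ↦ Y w.1 + ρ • w.2) (Y := fun w ↦ Y w.1 + ρ • w.2 + δ • u (Y w.1))
    (by fun_prop) (by fun_prop)
  have s3 := partialTransport_map ((γ.prod ν).prod γ)
    (X := fun w ↦ Y w.1 + ρ • w.2 + δ • V w.1)
    (Y := fun w ↦ diagMap (pathScale B σ (t + δ)) w.1.1 + (1 - (t + δ)) • w.1.2 + ρ • w.2)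
    (by fun_prop) (by fun_prop)
  have hprob : ∀ W : (EuclideanSpace ℝ (Fin d) × EuclideanSpace ℝ (Fin d)) ×
      EuclideanSpace ℝ (Fin d) → EuclideanSpace ℝ (Fin d), Measurable W →
      IsProbabilityMeasure (((γ.prod ν).prod γ).map W) := fun W hW ↦
    Measure.isProbabilityMeasure_map hW.aemeasurable
  have := hprob (fun w ↦ Y w.1 + ρ • w.2) (by fun_prop)
  have := hprob (fun w ↦ Y w.1 + ρ • w.2 + δ • u (Y w.1)) (by fun_prop)
  have := hprob (fun w ↦ Y w.1 + ρ • w.2 + δ • V w.1) (by fun_prop)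
  have := hprob (fun w ↦ diagMap (pathScale B σ (t + δ)) w.1.1 + (1 - (t + δ)) • w.1.2 + ρ • w.2)
    (by fun_prop)
  refine ((s1.trans s2).trans s3).mono ?_ (by simp)
  rw [add_zero, ENNReal.ofReal_add (by positivity) (by positivity)]
  refine add_le_add ?_ ?_
  · rw [ENNReal.ofReal_mul hδ]
    refine (eLpNorm_le_mul_eLpNorm_of_ae_le_mul (g := fun w : (EuclideanSpace ℝ (Fin d) ×
      EuclideanSpace ℝ (Fin d)) × EuclideanSpace ℝ (Fin d) ↦ u (Y w.1)) (c := δ)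
      (Filter.Eventually.of_forall fun w ↦ ?_) 2).trans ?_
    · rw [sub_add_cancel_left, norm_neg, norm_smul, Real.norm_of_nonneg hδ]
    · gcongr
      exact (eLpNorm_comp_measurePreserving (g := fun z ↦ u (Y z))
        hUm.aestronglyMeasurable measurePreserving_fst).trans_le hun
  -- The coefficient of the bounded vector is linear in time, so its increment is exact and only the
  -- Gaussian coordinate carries an error.
  · have hR : ∀ j, |A j + δ * M j - pathScale B σ (t + δ) j| ≤ δ ^ 2 * β := by
      intro j
      refine abs_add_mul_div_sub_le (B := B j) (c := 1 - t) hβ (h.variance_nonneg j)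
        (h.variance_le j) hδ (by linarith) (by linarith) (hAβ j)
        (hsq (t + δ) (by linarith) htδ j).2.2 (hsq t ht ht1 j).1 ?_
      rw [(hsq (t + δ) (by linarith) htδ j).1]
      ring
    refine le_trans (le_of_eq ?_) (eLpNorm_diagMap_stdGaussian_le (by positivity) hR)
    rw [← eLpNorm_comp_measurePreserving (Measurable.aestronglyMeasurable (by fun_prop))
      ((measurePreserving_fst (μ := γ) (ν := ν)).comp
        (measurePreserving_fst (μ := γ.prod ν) (ν := γ)))]
    congr 1
    ext w j
    simp [hY, hV]
    ring

lemma pathLaw_chain (h : IsCenteredBounded ν σ β) (hβ : 0 < β) (hρ : 0 < ρ)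
    (hBβ : ∀ j, 2 * β ^ 2 ≤ B j) (hBσ : ∀ j, σ j ≤ q * B j) (hq0 : 0 ≤ q) (hq : q ≤ 1 / 2)
    {δ : ℝ} (hδ : 0 ≤ δ) (i : ℕ) (hi : i * δ ≤ 1) :
    PartialTransport (pathLaw ν B σ ρ 0) (pathLaw ν B σ ρ (i * δ))
      (ENNReal.ofReal (i * (δ * (13 / 5 * β * √d * q) + δ ^ 2 * β * √d)))
      (ENNReal.ofReal (i * (3 * (δ / ρ) ^ 2 *
        ((β * √d + β) ^ 2 + (13 / 5 * β * √d * q) ^ 2)))) := by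
  induction i with
  | zero =>
    simpa using (partialTransport_of_measure_le (η := 0) fun s _ ↦ by simp :
      PartialTransport (pathLaw ν B σ ρ 0) (pathLaw ν B σ ρ 0) 0 0)
  | succ i ih =>
    push_cast at hi ⊢
    have e : ((i : ℝ) + 1) * δ = i * δ + δ := by ring
    rw [e] at hi ⊢
    have := (ih (by linarith)).trans (pathLaw_step h hβ hρ hBβ hBσ hq0 hq (t := i * δ)
      (by positivity) hδ hi)
    refine this.mono (le_of_eq ?_) (le_of_eq ?_)
    · rw [← ENNReal.ofReal_add (by positivity) (by positivity)]
      congr 1; ring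
    · rw [← ENNReal.ofReal_add (by positivity) (by positivity)]
      congr 1; ring

/-- With N equal steps, the curvature errors and the missing masses are O(1/N²) each and sum to
O(1/N). The noise scale `ρ` affects only the missing mass, so it is absent from the limiting cost.
-/
lemma nearTransport_pathLaw (h : IsCenteredBounded ν σ β) (hβ : 0 < β) (hρ : 0 < ρ)
    (hBβ : ∀ j, 2 * β ^ 2 ≤ B j) (hBσ : ∀ j, σ j ≤ q * B j) (hq0 : 0 ≤ q) (hq : q ≤ 1 / 2) :
    NearTransport (pathLaw ν B σ ρ 0) (pathLaw ν B σ ρ 1)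
      (ENNReal.ofReal (13 / 5 * β * √d * q)) := by
  intro ε hε
  -- The tolerance may be infinite; a positive real below it is used to choose the number of steps.
  obtain ⟨r, hr0, hr⟩ := ENNReal.lt_iff_exists_nnreal_btwn.1 hε
  have hr0 : (0 : ℝ) < r := by exact_mod_cast hr0
  set D : ℝ := 3 / ρ ^ 2 * ((β * √d + β) ^ 2 + (13 / 5 * β * √d * q) ^ 2) with hD
  have hD0 : 0 ≤ D := by positivity
  obtain ⟨N, hN⟩ := exists_nat_gt ((β * √d + D) / r)
  have hN0 : (0 : ℝ) < N := lt_of_le_of_lt (by positivity) hN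
  rw [div_lt_iff₀ hr0] at hN
  have hc := pathLaw_chain h hβ hρ hBβ hBσ hq0 hq (δ := 1 / N) (by positivity) N
    (by rw [mul_one_div_cancel hN0.ne'])
  rw [mul_one_div_cancel hN0.ne'] at hc
  have hrε : ENNReal.ofReal r ≤ ε := by simpa using hr.le
  refine hc.mono ?_ (le_trans (ENNReal.ofReal_le_ofReal ?_) hrε)
  · refine le_trans ?_ (add_le_add le_rfl hrε)
    rw [← ENNReal.ofReal_add (by positivity) hr0.le]
    refine ENNReal.ofReal_le_ofReal ?_
    have : (N : ℝ) * (1 / N * (13 / 5 * β * √d * q) + (1 / N) ^ 2 * β * √d) =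
        13 / 5 * β * √d * q + β * √d / N := by field_simp
    rw [this]
    gcongr
    rw [div_le_iff₀ hN0]
    linarith
  · have : (N : ℝ) * (3 * (1 / N / ρ) ^ 2 *
        ((β * √d + β) ^ 2 + (13 / 5 * β * √d * q) ^ 2)) = D / N := by
      rw [hD]; field_simp
    rw [this, div_le_iff₀ hN0]
    have : 0 ≤ β * √d := by positivity
    linarith

end Path

/-! ### Diagonal Gaussians and the exchange of one summand -/

/-- The centered Gaussian measure with diagonal covariance `v`. -/
noncomputable def diagGaussian {d : ℕ} (v : Fin d → ℝ) : Measure (EuclideanSpace ℝ (Fin d)) :=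
  (stdGaussian (EuclideanSpace ℝ (Fin d))).map (fun x ↦ diagMap (fun j ↦ √(v j)) x)

instance {d : ℕ} (v : Fin d → ℝ) : IsProbabilityMeasure (diagGaussian v) :=
  Measure.isProbabilityMeasure_map (by fun_prop)

lemma charFun_map_diagMap {d : ℕ} (f : Fin d → ℝ) (t : EuclideanSpace ℝ (Fin d)) :
    charFun ((stdGaussian (EuclideanSpace ℝ (Fin d))).map (fun x ↦ diagMap f x)) t =
      Complex.exp ((-(∑ j, f j ^ 2 * t j ^ 2) / 2 : ℝ)) := by
  have e : charFun ((stdGaussian (EuclideanSpace ℝ (Fin d))).map (fun x ↦ diagMap f x)) t =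
      charFun (stdGaussian (EuclideanSpace ℝ (Fin d))) (diagMap f t) := by
    rw [charFun_apply, integral_map (by fun_prop) (by fun_prop), charFun_apply]
    congr 1
    ext x
    simp [PiLp.inner_apply, mul_assoc, mul_left_comm]
  rw [e, charFun_stdGaussian, ← norm_diagMap_sq]
  push_cast
  rfl

lemma charFun_diagGaussian {d : ℕ} {v : Fin d → ℝ} (hv : ∀ j, 0 ≤ v j)
    (t : EuclideanSpace ℝ (Fin d)) :
    charFun (diagGaussian v) t = Complex.exp ((-(∑ j, v j * t j ^ 2) / 2 : ℝ)) := by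
  simp_rw [diagGaussian, charFun_map_diagMap, Real.sq_sqrt (hv _)]

lemma diagGaussian_conv {d : ℕ} {v w : Fin d → ℝ} (hv : ∀ j, 0 ≤ v j) (hw : ∀ j, 0 ≤ w j) :
    diagGaussian v ∗ diagGaussian w = diagGaussian (fun j ↦ v j + w j) := by
  refine Measure.ext_of_charFun (funext fun t ↦ ?_)
  rw [charFun_conv, charFun_diagGaussian hv, charFun_diagGaussian hw,
    charFun_diagGaussian (fun j ↦ add_nonneg (hv j) (hw j)), ← Complex.exp_add, ← Complex.ofReal_add]
  simp_rw [add_mul, Finset.sum_add_distrib]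
  congr 2
  ring

lemma map_smul_stdGaussian {d : ℕ} (ρ : ℝ) :
    (stdGaussian (EuclideanSpace ℝ (Fin d))).map (fun x ↦ ρ • x) =
      diagGaussian (fun _ ↦ ρ ^ 2) := by
  refine Measure.ext_of_charFun (funext fun t ↦ ?_)
  rw [charFun_diagGaussian (fun _ ↦ sq_nonneg ρ), ← charFun_map_diagMap (fun _ ↦ ρ)]
  congr 2

lemma map_prod_add_eq_conv {E F G : Type*} [MeasurableSpace E] [MeasurableSpace F]
    [AddMonoid G] [MeasurableSpace G] [MeasurableAdd₂ G] (μ : Measure E) (ν : Measure F)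
    [SFinite μ] [SFinite ν] {f : E → G} {g : F → G} (hf : Measurable f) (hg : Measurable g) :
    (μ.prod ν).map (fun z ↦ f z.1 + g z.2) = (μ.map f) ∗ (ν.map g) := by
  rw [Measure.conv, Measure.map_prod_map _ _ hf hg, Measure.map_map measurable_add (by fun_prop)]
  rfl

lemma pathLaw_eq {d : ℕ} (ν : Measure (EuclideanSpace ℝ (Fin d))) [IsProbabilityMeasure ν]
    (B σ : Fin d → ℝ) (ρ t : ℝ) :
    pathLaw ν B σ ρ t = (diagGaussian (fun j ↦ B j + (1 - (1 - t) ^ 2) * σ j) ∗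
      ν.map (fun x ↦ (1 - t) • x)) ∗ diagGaussian (fun _ ↦ ρ ^ 2) := by
  rw [pathLaw, map_prod_add_eq_conv _ _ (f := fun z : EuclideanSpace ℝ (Fin d) ×
    EuclideanSpace ℝ (Fin d) ↦ diagMap (pathScale B σ t) z.1 + (1 - t) • z.2)
    (g := fun x ↦ ρ • x) (by fun_prop) (by fun_prop), map_prod_add_eq_conv _ _
    (f := fun x ↦ diagMap (pathScale B σ t) x) (g := fun x ↦ (1 - t) • x) (by fun_prop)
    (by fun_prop), map_smul_stdGaussian]
  rfl

/-- Replacing a centered bounded vector by a Gaussian with the same covariance, in the presence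
of a large independent Gaussian. -/
lemma nearTransport_diagGaussian_conv {d : ℕ} {ν : Measure (EuclideanSpace ℝ (Fin d))}
    [IsProbabilityMeasure ν] {σ B : Fin d → ℝ} {β q ρ : ℝ} (h : IsCenteredBounded ν σ β)
    (hβ : 0 < β) (hρ : 0 < ρ) (hBβ : ∀ j, 2 * β ^ 2 ≤ B j) (hBσ : ∀ j, σ j ≤ q * B j)
    (hq0 : 0 ≤ q) (hq : q ≤ 1 / 2) :
    NearTransport (diagGaussian (fun j ↦ B j + ρ ^ 2) ∗ ν)
      (diagGaussian (fun j ↦ B j + σ j + ρ ^ 2)) (ENNReal.ofReal (13 / 5 * β * √d * q)) := by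
  have hB : ∀ j, 0 ≤ B j := fun j ↦ (by positivity : 0 ≤ 2 * β ^ 2).trans (hBβ j)
  have hρ2 : ∀ _ : Fin d, 0 ≤ ρ ^ 2 := fun _ ↦ sq_nonneg ρ
  -- At time 0 the path is Gaussian with covariance B convolved with ν; at time 1 the weight of ν is
  -- zero and the covariance is B + σ. Both carry the extra smoothing.
  have := nearTransport_pathLaw (ρ := ρ) h hβ hρ hBβ hBσ hq0 hq
  convert this using 1
  · rw [pathLaw_eq, ← diagGaussian_conv hB hρ2]
    refine Measure.ext_of_charFun (funext fun t ↦ ?_)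
    simp only [sub_zero, one_pow, sub_self, zero_mul, add_zero, one_smul, Measure.map_id',
      charFun_conv]
    ring
  · rw [pathLaw_eq, ← diagGaussian_conv (v := fun j ↦ B j + σ j)
      (fun j ↦ add_nonneg (hB j) (h.variance_nonneg j)) hρ2]
    refine Measure.ext_of_charFun (funext fun t ↦ ?_)
    simp only [sub_self, ne_eq, OfNat.ofNat_ne_zero, not_false_eq_true, zero_pow, sub_zero,
      one_mul, charFun_conv]
    rw [charFun_map_smul]
    simp

/-! ### Exchanging the summands one by one -/

/-- The convolution of a finite family of measures. -/
noncomputable def convFin {d : ℕ} : ∀ {m : ℕ}, (Fin m → Measure (EuclideanSpace ℝ (Fin d))) →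
    Measure (EuclideanSpace ℝ (Fin d))
  | 0, _ => Measure.dirac 0
  | m + 1, ν => convFin (fun i : Fin m ↦ ν i.castSucc) ∗ ν (Fin.last m)

section ConvFin

variable {d : ℕ}

instance isProbabilityMeasure_convFin {m : ℕ} (ν : Fin m → Measure (EuclideanSpace ℝ (Fin d)))
    [h : ∀ i, IsProbabilityMeasure (ν i)] : IsProbabilityMeasure (convFin ν) := by
  induction m with
  | zero => exact Measure.dirac.isProbabilityMeasure
  | succ m ih =>
    have := ih (fun i ↦ ν i.castSucc)
    exact inferInstanceAs (IsProbabilityMeasure (_ ∗ _))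

lemma charFun_convFin {m : ℕ} (ν : Fin m → Measure (EuclideanSpace ℝ (Fin d)))
    [h : ∀ i, IsProbabilityMeasure (ν i)] : charFun (convFin ν) = ∏ i, charFun (ν i) := by
  induction m with
  | zero => ext t; simp [convFin, charFun_dirac]
  | succ m ih =>
    ext t
    rw [convFin, charFun_conv, ih, Fin.prod_univ_castSucc]
    rfl

/-- Here `k` counts the summands already exchanged. The last remaining one is exchanged next, with
the others convolved in as spectators, and the costs 1/(k + 2) telescope into logarithms. -/
lemma nearTransport_diagGaussian_conv_convFin {m : ℕ}
    (ν : Fin m → Measure (EuclideanSpace ℝ (Fin d))) [hν : ∀ i, IsProbabilityMeasure (ν i)]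
    {σ : Fin d → ℝ} {β : ℝ} (hβ : 0 < β) (h : ∀ i, IsCenteredBounded (ν i) σ β) (k : ℕ) :
    NearTransport (diagGaussian (fun j ↦ k * σ j + (3 / 2 * β) ^ 2) ∗ convFin ν)
      (diagGaussian (fun j ↦ (k + m : ℕ) * σ j + (3 / 2 * β) ^ 2))
      (ENNReal.ofReal (13 / 5 * β * √d * (Real.log (k + m + 1) - Real.log (k + 1)))) := by
  induction m generalizing k with
  | zero =>
    intro ε hε
    refine (partialTransport_of_measure_le (η := 0) fun s _ ↦ ?_).mono zero_le zero_le
    have : diagGaussian (fun j ↦ k * σ j + (3 / 2 * β) ^ 2) ∗ convFin ν =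
        diagGaussian (fun j ↦ ((k + 0 : ℕ) : ℝ) * σ j + (3 / 2 * β) ^ 2) := by
      simp [convFin, Measure.conv_dirac_zero]
    rw [this, add_zero, add_zero]
  | succ m ih =>
    have hσ0 := (h (Fin.last m)).variance_nonneg
    have hσ := (h (Fin.last m)).variance_le
    have hk : (0 : ℝ) < k + 2 := by positivity
    -- The auxiliary variance splits as (3β/2)² = 2β² + (β/2)²: the first part provides the lower
    -- bound on `B`, the second is the smoothing noise. Since σ ≤ β², (k + 2)σ ≤ kσ + 2β², whence
    -- this `q`.
    have s1 := nearTransport_diagGaussian_conv (ρ := β / 2) (q := 1 / (k + 2))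
      (B := fun j ↦ k * σ j + 2 * β ^ 2) (h (Fin.last m)) hβ (by positivity)
      (fun j ↦ le_add_of_nonneg_left (mul_nonneg k.cast_nonneg (hσ0 j)))
      (fun j ↦ by
        rw [one_div_mul_eq_div, le_div_iff₀ hk]
        nlinarith [hσ j]) (by positivity)
      (one_div_le_one_div_of_le (by norm_num) (by linarith [(Nat.cast_nonneg k : (0 : ℝ) ≤ k)]))
    have s2 := ih (fun i ↦ ν i.castSucc) (fun i ↦ h i.castSucc) (k + 1)
    have e1 : (fun j ↦ k * σ j + 2 * β ^ 2 + (β / 2) ^ 2) =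
        fun j ↦ k * σ j + (3 / 2 * β) ^ 2 := by ext j; ring
    have e2 : (fun j ↦ k * σ j + 2 * β ^ 2 + σ j + (β / 2) ^ 2) =
        fun j ↦ (k + 1 : ℕ) * σ j + (3 / 2 * β) ^ 2 := by ext j; push_cast; ring
    rw [e1, e2] at s1
    have s3 := (s1.conv (ρ := convFin (fun i ↦ ν i.castSucc))).trans s2
    have e3 : diagGaussian (fun j ↦ k * σ j + (3 / 2 * β) ^ 2) ∗ convFin ν =
        (diagGaussian (fun j ↦ k * σ j + (3 / 2 * β) ^ 2) ∗ ν (Fin.last m)) ∗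
          convFin (fun i ↦ ν i.castSucc) := by
      refine Measure.ext_of_charFun (funext fun t ↦ ?_)
      simp only [convFin, charFun_conv]
      ring
    rw [e3]
    have e4 : k + (m + 1) = k + 1 + m := by ring
    rw [e4]
    refine s3.mono ?_
    have hl1 : Real.log (k + 1) ≤ Real.log (k + 2) :=
      Real.log_le_log (by positivity) (by linarith)
    have hl2 : Real.log (k + 2) ≤ Real.log (k + 2 + m) :=
      Real.log_le_log (by positivity) (by linarith [(Nat.cast_nonneg m : (0 : ℝ) ≤ m)])
    -- This is 1 - 1/x ≤ log x at x = (k + 2)/(k + 1).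
    have hl3 : 1 / ((k : ℝ) + 2) ≤ Real.log (k + 2) - Real.log (k + 1) := by
      rw [← Real.log_div (by positivity) (by positivity)]
      refine le_trans (le_of_eq ?_) (Real.one_sub_inv_le_log_of_pos (by positivity))
      field_simp
      ring
    push_cast
    have e5 : (k : ℝ) + 1 + m + 1 = k + 2 + m := by ring
    have e6 : (k : ℝ) + (m + 1) + 1 = k + 2 + m := by ring
    have e7 : (k : ℝ) + 1 + 1 = k + 2 := by ring
    rw [e5, e6, e7, ← ENNReal.ofReal_add (by positivity)
      (mul_nonneg (by positivity) (by linarith))]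
    refine ENNReal.ofReal_le_ofReal ?_
    rw [← mul_add]
    gcongr
    linarith

lemma nearTransport_smooth (μ : Measure (EuclideanSpace ℝ (Fin d))) [IsProbabilityMeasure μ]
    {ρ : ℝ} (hρ : 0 ≤ ρ) :
    NearTransport μ (diagGaussian (fun _ ↦ ρ ^ 2) ∗ μ) (ENNReal.ofReal (ρ * √d)) := by
  have := nearTransport_map ((stdGaussian (EuclideanSpace ℝ (Fin d))).prod μ)
    (X := fun z ↦ z.2) (Y := fun z ↦ ρ • z.1 + z.2) (by fun_prop) (by fun_prop)
  rw [map_prod_add_eq_conv _ _ (f := fun x ↦ ρ • x) (g := fun x ↦ x) (by fun_prop) (by fun_prop),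
    map_smul_stdGaussian, Measure.map_id', measurePreserving_snd.map_eq] at this
  refine this.mono ?_
  refine (eLpNorm_le_mul_eLpNorm_of_ae_le_mul (g := fun w : EuclideanSpace ℝ (Fin d) ×
      EuclideanSpace ℝ (Fin d) ↦ w.1) (c := ρ) (Filter.Eventually.of_forall fun w ↦ ?_) 2).trans ?_
  · rw [sub_add_cancel_right, norm_neg, norm_smul, Real.norm_of_nonneg hρ]
  · rw [ENNReal.ofReal_mul hρ]
    gcongr
    exact ((eLpNorm_comp_measurePreserving (g := fun x : EuclideanSpace ℝ (Fin d) ↦ x)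
      (by fun_prop) measurePreserving_fst).trans (eLpNorm_id_stdGaussian d)).le

/-- Adding and removing the auxiliary Gaussian costs 3β√d/2 each, and the exchanges cost 13/5 β√d
log(n + 1). -/
lemma nearTransport_convFin {n : ℕ} (hn : 1 ≤ n)
    (ν : Fin n → Measure (EuclideanSpace ℝ (Fin d))) [hν : ∀ i, IsProbabilityMeasure (ν i)]
    {σ : Fin d → ℝ} {β : ℝ} (hβ : 0 < β) (h : ∀ i, IsCenteredBounded (ν i) σ β) :
    NearTransport (convFin ν) (diagGaussian (fun j ↦ n * σ j))
      (ENNReal.ofReal (5 * √d * β * (1 + Real.log n))) := by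
  have hσ0 := (h ⟨0, hn⟩).variance_nonneg
  have s1 := nearTransport_smooth (convFin ν) (ρ := 3 / 2 * β) (by positivity)
  have s2 := nearTransport_diagGaussian_conv_convFin ν hβ h 0
  have s3 := (nearTransport_smooth (diagGaussian (fun j ↦ n * σ j)) (ρ := 3 / 2 * β)
    (by positivity)).symm
  rw [diagGaussian_conv (fun _ ↦ sq_nonneg _) (fun j ↦ mul_nonneg n.cast_nonneg (hσ0 j))] at s3
  simp only [Nat.cast_zero, zero_mul, zero_add, Real.log_one, sub_zero] at s2
  simp_rw [add_comm _ ((_ : ℝ) * σ _)] at s3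
  refine ((s1.trans s2).trans s3).mono ?_
  have hn' : (1 : ℝ) ≤ n := by exact_mod_cast hn
  have hl0 : 0 ≤ Real.log n := Real.log_nonneg hn'
  have hl1 : 0 ≤ Real.log (n + 1) := Real.log_nonneg (by linarith)
  have hl : Real.log (n + 1) ≤ 7 / 10 + Real.log n :=
    calc Real.log (n + 1) ≤ Real.log (2 * n) := Real.log_le_log (by positivity) (by linarith)
      _ = Real.log 2 + Real.log n := Real.log_mul (by norm_num) (by positivity)
      _ ≤ _ := by linarith [Real.log_two_lt_d9]
  rw [← ENNReal.ofReal_add (by positivity) (by positivity),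
    ← ENNReal.ofReal_add (by positivity) (by positivity)]
  refine ENNReal.ofReal_le_ofReal ?_
  -- The constants fit because 3 + (13/5)(7/10) = 4.82 ≤ 5 and 13/5 ≤ 5.
  have hD : 0 ≤ √d * β := by positivity
  nlinarith

end ConvFin

/-! ### Diagonalising the covariance, and conclusion -/

lemma HasCovMatrix.isHermitian {Ω : Type*} [MeasurableSpace Ω] {P : Measure Ω} {d : ℕ}
    {X : Ω → EuclideanSpace ℝ (Fin d)} {S : Matrix (Fin d) (Fin d) ℝ}
    (hS : HasCovMatrix X S P) : S.IsHermitian := by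
  ext j k
  rw [Matrix.conjTranspose_apply, star_trivial, ← hS j k, ← hS k j, covariance_comm]

section Moments

variable {Ω : Type*} [MeasurableSpace Ω] {P : Measure Ω} [IsProbabilityMeasure P] {d : ℕ}
  {X : Ω → EuclideanSpace ℝ (Fin d)} {S : Matrix (Fin d) (Fin d) ℝ}

lemma HasCovMatrix.hasIntegral_inner_mul_inner (hS : HasCovMatrix X S P) (hX : MemLp X 2 P)
    (hX0 : ∫ ω, X ω ∂P = 0) (u v : EuclideanSpace ℝ (Fin d)) :
    HasIntegral P (fun ω ↦ (inner ℝ u (X ω) : ℝ) * inner ℝ v (X ω))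
      (u.ofLp ⬝ᵥ S.mulVec v.ofLp) := by
  have hp : ∀ j, MemLp (fun ω ↦ X ω j) 2 P := fun j ↦
    (EuclideanSpace.proj j : EuclideanSpace ℝ (Fin d) →L[ℝ] ℝ).comp_memLp' hX
  have hm : ∀ j, ∫ ω, X ω j ∂P = 0 := by
    intro j
    have := (EuclideanSpace.proj j : EuclideanSpace ℝ (Fin d) →L[ℝ] ℝ).integral_comp_comm
      (hX.integrable (by norm_num))
    rw [hX0, map_zero] at this
    simpa using this
  have hjk : ∀ j k, HasIntegral P (fun ω ↦ X ω j * X ω k) (S j k) := by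
    intro j k
    refine ⟨(hp j).integrable_mul (hp k), ?_⟩
    have := hS j k
    rw [covariance_eq_sub (hp j) (hp k), hm j, zero_mul, sub_zero] at this
    exact this
  have := hasIntegral_finsetSum Finset.univ fun j _ ↦ hasIntegral_finsetSum Finset.univ fun k _ ↦
    (hjk j k).const_mul (u j * v k)
  refine this.congr (fun ω ↦ ?_) ?_
  · simp only [PiLp.inner_apply, Real.inner_apply, Finset.sum_mul_sum]
    exact Finset.sum_congr rfl fun j _ ↦ Finset.sum_congr rfl fun k _ ↦ by ring
  · simp only [dotProduct, Matrix.mulVec, Finset.mul_sum]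
    exact Finset.sum_congr rfl fun j _ ↦ Finset.sum_congr rfl fun k _ ↦ by ring

lemma HasCovMatrix.hasIntegral_repr_mul_repr (hS : HasCovMatrix X S P) (hX : MemLp X 2 P)
    (hX0 : ∫ ω, X ω ∂P = 0) (hH : S.IsHermitian) (i j : Fin d) :
    HasIntegral P (fun ω ↦ hH.eigenvectorBasis.repr (X ω) i * hH.eigenvectorBasis.repr (X ω) j)
      (if i = j then hH.eigenvalues i else 0) := by
  refine (hS.hasIntegral_inner_mul_inner hX hX0 (hH.eigenvectorBasis i)
    (hH.eigenvectorBasis j)).congr (fun ω ↦ ?_) ?_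
  · simp only [OrthonormalBasis.repr_apply_apply]
  · have := hH.eigenvectorBasis.inner_eq_ite j i
    rw [EuclideanSpace.inner_eq_star_dotProduct] at this
    rw [hH.mulVec_eigenvectorBasis, dotProduct_smul]
    simp only [star_trivial] at this
    rw [this]
    by_cases hij : i = j
    · simp [hij]
    · simp [hij, Ne.symm hij]

/-- A Gaussian law is determined by its mean and covariance; comparing characteristic functions
requires no density, so zero variances are allowed. -/
lemma HasGaussianLaw.map_eq_diagGaussian (hX : HasGaussianLaw X P) (hX0 : ∫ ω, X ω ∂P = 0)
    {v : Fin d → ℝ} (hv : ∀ j, 0 ≤ v j)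
    (hcov : ∀ i j, HasIntegral P (fun ω ↦ X ω i * X ω j) (if i = j then v i else 0)) :
    P.map X = diagGaussian v := by
  refine Measure.ext_of_charFun (funext fun t ↦ ?_)
  have hm : ∫ ω, (inner ℝ t (X ω) : ℝ) ∂P = 0 := by
    rw [integral_inner hX.integrable, hX0, inner_zero_right]
  have hvar : HasIntegral P (fun ω ↦ (inner ℝ t (X ω) : ℝ) ^ 2) (∑ j, v j * t j ^ 2) := by
    refine (hasIntegral_finsetSum Finset.univ fun i _ ↦ hasIntegral_finsetSum Finset.univ
      fun j _ ↦ (hcov i j).const_mul (t i * t j)).congr (fun ω ↦ ?_) ?_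
    · simp only [PiLp.inner_apply, Real.inner_apply, sq, Finset.sum_mul_sum]
      exact Finset.sum_congr rfl fun j _ ↦ Finset.sum_congr rfl fun k _ ↦ by ring
    · refine Finset.sum_congr rfl fun i _ ↦ ?_
      simp only [mul_ite, mul_zero, Finset.sum_ite_eq, Finset.mem_univ, if_true]
      ring
  have ha : AEMeasurable (fun ω ↦ (inner ℝ t (X ω) : ℝ)) P := by
    have := hX.aemeasurable
    fun_prop
  rw [hX.charFun_map_eq, variance_of_integral_eq_zero ha hm, hvar.2, hm, charFun_diagGaussian hv]
  push_cast
  congr 1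
  ring

end Moments

lemma iIndepFun.map_sum_eq_convFin {Ω : Type*} [MeasurableSpace Ω] {P : Measure Ω}
    [IsProbabilityMeasure P] {d n : ℕ} {Y : Fin n → Ω → EuclideanSpace ℝ (Fin d)}
    (hY : ∀ i, AEMeasurable (Y i) P) (h : iIndepFun Y P) :
    P.map (fun ω ↦ ∑ i, Y i ω) = convFin (fun i ↦ P.map (Y i)) := by
  have : ∀ i, IsProbabilityMeasure (P.map (Y i)) := fun i ↦
    Measure.isProbabilityMeasure_map (hY i)
  refine Measure.ext_of_charFun ?_
  rw [ProbabilityTheory.iIndepFun.charFun_map_fun_sum_eq_prod hY h, charFun_convFin]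

lemma lintegral_enorm_rpow_map_ne_top {Ω E : Type*} [MeasurableSpace Ω] [NormedAddCommGroup E]
    [MeasurableSpace E] [BorelSpace E] {P : Measure Ω} {X : Ω → E} (hXm : AEMeasurable X P)
    (hX : MemLp X 2 P) : ∫⁻ x, ‖x‖ₑ ^ (2 : ℝ) ∂(P.map X) ≠ ∞ := by
  rw [lintegral_map' (by fun_prop) hXm]
  have := (eLpNorm_lt_top_iff_lintegral_rpow_enorm_lt_top (by norm_num) (by norm_num)).1 hX.2
  simpa using this.ne

/-- In eigenvector coordinates of `S` the summands keep their norms and acquire diagonal covariance.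
The unnormalised sum is compared with √n Z there, and the result is carried back. -/
lemma transportDist_sum_le_of_pos {Ω Ω' : Type*} [MeasurableSpace Ω] [MeasurableSpace Ω']
    (P : Measure Ω) [IsProbabilityMeasure P] (P' : Measure Ω') [IsProbabilityMeasure P']
    {d n : ℕ} (hn : 1 ≤ n) {β : ℝ} (hβ : 0 < β) {S : Matrix (Fin d) (Fin d) ℝ}
    {X : Fin n → Ω → EuclideanSpace ℝ (Fin d)} (hX_meas : ∀ i, AEMeasurable (X i) P)
    (hX_indep : iIndepFun X P) (hX_mean : ∀ i, ∫ ω, X i ω ∂P = 0)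
    (hX_cov : ∀ i, HasCovMatrix (X i) S P) (hX_bound : ∀ i, ∀ᵐ ω ∂P, ‖X i ω‖ ≤ β)
    {Z : Ω' → EuclideanSpace ℝ (Fin d)} (hZ_gauss : HasGaussianLaw Z P')
    (hZ_mean : ∫ ω, Z ω ∂P' = 0) (hZ_cov : HasCovMatrix Z S P') :
    transportDist 2 (P.map (fun ω ↦ (1 / √(n : ℝ)) • ∑ i, X i ω)) (P'.map Z) ≤
      ENNReal.ofReal (5 * √(d : ℝ) * β * (1 + Real.log n) / √(n : ℝ)) := by
  have hH := (hX_cov ⟨0, hn⟩).isHermitian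
  set b := hH.eigenvectorBasis with hb
  have hn0 : (0 : ℝ) < √n := Real.sqrt_pos.2 (by exact_mod_cast hn)
  have hbm : Measurable fun x ↦ b.repr x := b.repr.continuous.measurable
  have hbm' : Measurable fun x ↦ b.repr.symm x := b.repr.symm.continuous.measurable
  have hXLp : ∀ i, MemLp (X i) 2 P := fun i ↦
    MemLp.of_bound (hX_meas i).aestronglyMeasurable β (hX_bound i)
  have hYm : ∀ i, AEMeasurable (fun ω ↦ b.repr (X i ω)) P := fun i ↦
    hbm.comp_aemeasurable (hX_meas i)
  have hY : ∀ i, IsCenteredBounded (P.map (fun ω ↦ b.repr (X i ω))) hH.eigenvalues β := by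
    intro i
    refine ⟨?_, ?_, fun j k ↦ ?_⟩
    · rw [ae_map_iff (hYm i) (measurableSet_le (by fun_prop) (by fun_prop))]
      simpa using hX_bound i
    · rw [integral_map (hYm i) (by fun_prop)]
      have := b.repr.toContinuousLinearEquiv.toContinuousLinearMap.integral_comp_comm
        ((hXLp i).integrable (by norm_num))
      rw [hX_mean i, map_zero] at this
      exact this
    · rw [integral_map (hYm i) (Measurable.aestronglyMeasurable (by fun_prop))]
      exact ((hX_cov i).hasIntegral_repr_mul_repr (hXLp i) (hX_mean i) hH j k).2
  have : ∀ i, IsProbabilityMeasure (P.map (fun ω ↦ b.repr (X i ω))) := fun i ↦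
    Measure.isProbabilityMeasure_map (hYm i)
  have hsum := iIndepFun.map_sum_eq_convFin hYm (hX_indep.comp (fun _ x ↦ b.repr x) fun _ ↦ hbm)
  have hZm := hZ_gauss.aemeasurable
  have hWm : AEMeasurable (fun ω ↦ √(n : ℝ) • b.repr (Z ω)) P' :=
    (hbm.const_smul √(n : ℝ)).comp_aemeasurable hZm
  have hW : P'.map (fun ω ↦ √(n : ℝ) • b.repr (Z ω)) =
      diagGaussian (fun j ↦ n * hH.eigenvalues j) := by
    refine HasGaussianLaw.map_eq_diagGaussian ((hZ_gauss.map_equiv_fun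
      b.repr.toContinuousLinearEquiv).fun_smul √(n : ℝ)) ?_
      (fun j ↦ mul_nonneg n.cast_nonneg ((hY ⟨0, hn⟩).variance_nonneg j)) fun i j ↦ ?_
    · have := b.repr.toContinuousLinearEquiv.toContinuousLinearMap.integral_comp_comm
        hZ_gauss.integrable
      rw [hZ_mean, map_zero] at this
      rw [integral_smul]
      exact smul_eq_zero_of_right _ this
    · refine ((hZ_cov.hasIntegral_repr_mul_repr hZ_gauss.memLp_two hZ_mean hH i j).const_mul
        n).congr (fun ω ↦ ?_) (by simp)
      have := Real.mul_self_sqrt (n.cast_nonneg : (0 : ℝ) ≤ n)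
      simp only [PiLp.smul_apply, smul_eq_mul]
      nth_rw 1 [← this]
      simp only [LinearIsometryEquiv.coe_toContinuousLinearEquiv]
      ring
  have hnear := nearTransport_convFin hn (fun i ↦ P.map (fun ω ↦ b.repr (X i ω))) hβ hY
  rw [← hsum, ← hW] at hnear
  have hfm : Measurable fun x : EuclideanSpace ℝ (Fin d) ↦ (1 / √(n : ℝ)) • b.repr.symm x :=
    hbm'.const_smul (1 / √(n : ℝ))
  -- Rotating back and dividing by √n multiplies every distance by exactly 1/√n.
  have hmap := hnear.map hfm (c := 1 / √(n : ℝ)) (by positivity) fun x y ↦ by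
    rw [← smul_sub, ← map_sub, norm_smul, LinearIsometryEquiv.norm_map,
      Real.norm_of_nonneg (by positivity)]
  rw [AEMeasurable.map_map_of_aemeasurable hfm.aemeasurable (Finset.aemeasurable_fun_sum _
    fun i _ ↦ hYm i), AEMeasurable.map_map_of_aemeasurable hfm.aemeasurable hWm] at hmap
  have e1 : ((fun x ↦ (1 / √(n : ℝ)) • b.repr.symm x) ∘ fun ω ↦ ∑ i, b.repr (X i ω)) =
      fun ω ↦ (1 / √(n : ℝ)) • ∑ i, X i ω := by
    ext1 ω
    simp only [Function.comp_apply]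
    rw [← map_sum, LinearIsometryEquiv.symm_apply_apply]
  have e2 : ((fun x ↦ (1 / √(n : ℝ)) • b.repr.symm x) ∘ fun ω ↦ √(n : ℝ) • b.repr (Z ω)) = Z := by
    ext1 ω
    simp only [Function.comp_apply]
    rw [map_smul, LinearIsometryEquiv.symm_apply_apply, smul_smul, one_div_mul_cancel hn0.ne',
      one_smul]
  rw [e1, e2, ← ENNReal.ofReal_mul (by positivity), one_div_mul_eq_div] at hmap
  have hSm : AEMeasurable (fun ω ↦ (1 / √(n : ℝ)) • ∑ i, X i ω) P :=
    (Finset.aemeasurable_fun_sum _ fun i _ ↦ hX_meas i).const_smul (1 / √(n : ℝ))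
  have : IsProbabilityMeasure (P.map fun ω ↦ (1 / √(n : ℝ)) • ∑ i, X i ω) :=
    Measure.isProbabilityMeasure_map hSm
  have : IsProbabilityMeasure (P'.map Z) := Measure.isProbabilityMeasure_map hZm
  exact hmap.transportDist_le
    (lintegral_enorm_rpow_map_ne_top hSm
      ((memLp_finsetSum _ fun i _ ↦ hXLp i).const_smul (1 / √(n : ℝ))))
    (lintegral_enorm_rpow_map_ne_top hZm hZ_gauss.memLp_two)

theorem theorem1
    {Ω Ω' : Type*} [MeasurableSpace Ω] [MeasurableSpace Ω']
    (P : Measure Ω) [IsProbabilityMeasure P] (P' : Measure Ω') [IsProbabilityMeasure P']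
    (d n : ℕ) (hn : 1 ≤ n) (β : ℝ) (S : Matrix (Fin d) (Fin d) ℝ)
    (X : Fin n → Ω → EuclideanSpace ℝ (Fin d))
    (hX_meas : ∀ i, AEMeasurable (X i) P)
    (hX_indep : iIndepFun X P)
    (hX_mean : ∀ i, ∫ ω, X i ω ∂P = 0)
    (hX_cov : ∀ i, HasCovMatrix (X i) S P)
    (hX_bound : ∀ i, ∀ᵐ ω ∂P, ‖X i ω‖ ≤ β)
    (Z : Ω' → EuclideanSpace ℝ (Fin d))
    (hZ_gauss : HasGaussianLaw Z P')
    (hZ_mean : ∫ ω, Z ω ∂P' = 0)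
    (hZ_cov : HasCovMatrix Z S P') :
    transportDist 2 (P.map (fun ω ↦ (1 / √(n : ℝ)) • ∑ i, X i ω)) (P'.map Z) ≤
      ENNReal.ofReal (5 * √(d : ℝ) * β * (1 + Real.log n) / √(n : ℝ)) := by
  have hβ : 0 ≤ β := by
    obtain ⟨ω, hω⟩ := (hX_bound ⟨0, hn⟩).exists
    exact (norm_nonneg _).trans hω
  -- Only β ≥ 0 is known, while the estimates need a positive bound. Every b > β is also a bound for
  -- the vectors, and the right side is continuous in b, so let b decrease to β.
  refine ge_of_tendsto (x := nhdsWithin β (Set.Ioi β)) (f := fun b ↦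
    ENNReal.ofReal (5 * √(d : ℝ) * b * (1 + Real.log n) / √(n : ℝ))) ?_ ?_
  · exact (ENNReal.continuous_ofReal.comp (g := ENNReal.ofReal)
      (by fun_prop : Continuous fun b ↦
        5 * √(d : ℝ) * b * (1 + Real.log n) / √(n : ℝ)) |>.tendsto β).mono_left nhdsWithin_le_nhds
  · filter_upwards [self_mem_nhdsWithin] with b hb
    exact transportDist_sum_le_of_pos P P' hn (hβ.trans_lt hb) hX_meas hX_indep hX_mean hX_cov
      (fun i ↦ (hX_bound i).mono fun ω h ↦ h.trans (le_of_lt hb)) hZ_gauss hZ_mean hZ_cov
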